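/- **Setting.** A *prediction oracle* over a domain $X$ receives a labeled dataset $S\in(X\times\{0,1\})^n$ and selects a (possibly randomized) hypothesis $h_0:X\to\{0,1\}$; then in each round $r=1,2,\dots$ it receives a query $x_r\in X$, outputs $h_{r-1}(x_r)$, and selects a hypothesis $h_r:X\to\{0,1\}$. For a distribution $\mathcal D$ on $X$ put ${\rm error}_{\mathcal D}(c,h)=\Pr_{x\sim\mathcal D}[h(x)\ne c(x)]$. The oracle is an *$(\alpha,\beta,\gamma,n)$-everlasting robust predictor* for the target $(c,\mathcal D)$ if for every adversary $\mathcal F$ the following holds. Let $S$ consist of $n$ i.i.d. samples from $\mathcal D$ labeled by $c$, and let each query $x_r$, independently with probability $\gamma$, be a fresh sample from $\mathcal D$, and otherwise be chosen by $\mathcal F$ as a (possibly randomized) function of $S$ and of all previous queries and predictions. Then $\Pr[\exists r\ge 0:\ {\rm error}_{\mathcal D}(c,h_r)>\alpha]\le\beta$. A *rectangle* in $\mathbb R^d$ is a concept $c$ with $c(x)=1$ iff $a_j\le x[j]\le b_j$ for all $j\in[d]$, where $a,b\in\mathbb R^d$. **Algorithm RectanglesPERP** (input $S$; parameters $d,\alpha,\beta,\gamma,\varepsilon,\delta^*$;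 constants $c_\delta,a_\delta,c_m,c_t,c_\Delta$). For $p=1,2,\dots$ let $\alpha_p=\alpha 2^{-p}$, $\beta_p=\beta 2^{-p}$, $Q_p=\frac{\delta^*\gamma\alpha\varepsilon^2\beta}{d\,8^p}$, and $$\delta_p=\frac{c_\delta Q_p}{\log^{a_\delta}(1/Q_p)},\quad m_p=\left\lceil\frac{c_m}{\varepsilon^2}\log^5\frac{d}{\alpha_p\beta_p\gamma\varepsilon\delta_p}\right\rceil,\quad k_p=2m_p,\quad t_p=\left\lceil\frac{c_t\,d\,m_p}{\gamma\alpha_p}\right\rceil,$$ $$\Delta_p=c_\Delta\frac{\log(1/\delta_p)}{\varepsilon}\sqrt{k_p\log\frac d{\delta_p}}\;\log\frac{d\,t_p}{\beta_p},\quad \varepsilon'_p=\frac{\varepsilon}{\log(1/\delta_p)},\quad \delta'_p=\frac{\delta_p}d,\quad k'_p=k_p+\frac8{\varepsilon'_p}\log\frac2{\delta'_p}\log\frac{t_p}{\delta'_p}.$$ All noises below are fresh and independent, and ${\rm Geom}(q)$ is supported on $\{0,1,2,\dots\}$ with $\Pr[i]=(1-q)^iq$. * *Beginning of phase $p$, from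 a labeled dataset* ($S$ if $p=1$). Take the positively labeled points. For $j=1,\dots,d$: first remove the $m_p+{\rm Geom}(1-e^{-\varepsilon'_p})$ remaining points with largest $j$th coordinate, which become the dataset of the copy $\mathrm{Right}_j$; then remove the $m_p+{\rm Geom}(1-e^{-\varepsilon'_p})$ remaining points with smallest $j$th coordinate, which become the dataset of $\mathrm{Left}_j$ (all remaining points if there are not enough). Every copy has a counter, set to $0$. Set $D=\emptyset$ and $D_j^{\rm left}=D_j^{\rm right}=\emptyset$ for all $j$. * *Round $i=1,2,\dots$, in phase $p$.* (1) Each copy halts if its counter plus ${\rm Lap}(\frac8{\varepsilon'_p}\log\frac2{\delta'_p})$ is at least $k_p$; a copy that halts gets $D_j^{\rm left}$ (for $\mathrm{Left}_j$) or $D_j^{\rm right}$ (for $\mathrm{Right}_j$) as its new dataset, this set is emptied, and the counter is reset to $0$. (2) On the query $x_i$, ask $\mathrm{Left}_1,\mathrm{Right}_1,\mathrm{Left}_2,\mathrm{Right}_2,\dots$ in this order: let $f$ be the number of points in the copy's dataset whose $j$th coordinate is bigger (for $\mathrm{Left}_j$) or smaller (for $\mathrm{Right}_j$) than $x_i[j]$,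 and let $\hat f=f+{\rm Lap}\big(\frac4{\varepsilon'_p}\sqrt{k'_p\log(4/\delta'_p)}\big)$. If $\hat f>2\Delta_p$ ("high"), stop asking, predict $0$, and add $(x_i,0)$ to $D$. If $\Delta_p\le\hat f\le2\Delta_p$ ("medium"), stop asking, predict $0$, add $x_i$ to $D_j^{\rm left}$ resp. $D_j^{\rm right}$, and increase the copy's counter by $1$. If $\hat f<\Delta_p$ ("low"), go on to the next copy. If all answers are "low", predict $1$ and add $(x_i,1)$ to $D$. (3) If $i=t_1+\dots+t_p$, begin phase $p+1$ from the dataset $D$. The hypothesis $h_{i-1}$ maps a point $x$ to the label which would be predicted in round $i$ on the query $x$ (with the noises of round $i$). **Theorem.** For all sufficiently large $c_t,c_\Delta$, all $c_m$ sufficiently large in terms of $c_t,c_\Delta$, all $0<c_\delta\le1$ and all integers $a_\delta\ge0$, there are $C>0$ and $K\in\mathbb N$, depending only on these constants, such that the following holds. Let $d\ge1$, $\alpha,\beta,\delta^*\in(0,1)$, $\gamma,\varepsilon\in(0,1]$, and let $$n\ \ge\ C\,\frac{d}{\alpha\varepsilon^2}\,\log^K\!\left(\frac{2d}{\alpha\beta\gamma\varepsilon\delta^*}\right).$$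 Then RectanglesPERP is an $(\alpha,\beta,\gamma,n)$-everlasting robust predictor for every target $(c,\mathcal D)$ consisting of a rectangle $c$ in $\mathbb R^d$ and a probability distribution $\mathcal D$ on $\mathbb R^d$ with $\Pr_{x\sim\mathcal D}[c(x)=1]>\alpha$. -/

import Mathlib

open MeasureTheory ProbabilityTheory

namespace PERP

noncomputable section

/-! ### Prediction oracles and everlasting robust prediction -/

/-- A (randomized) prediction oracle over the domain `X`. All the internal randomness is read off a
random tape. `hyp tape S x` is the hypothesis `h_r` which the oracle holds after it has received
the labeled dataset `S` (of size `n`) and the first `r` queries `x 0, …, x (r - 1)`. The oracle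
answers the next query `y` by `h_r y`. -/
structure PredictionOracle (X : Type) where
  Tape : Type
  [tapeSpace : MeasurableSpace Tape]
  law : Measure Tape
  [isProb : IsProbabilityMeasure law]
  hyp : Tape → {n : ℕ} → (Fin n → X × Bool) → {r : ℕ} → (Fin r → X) → X → Bool

attribute [instance] PredictionOracle.tapeSpace PredictionOracle.isProb

/-- A (randomized, adaptive) adversary: before round `r + 1` it proposes a query, as a function of
its private random seed, of the labeled dataset given to the oracle, and of the `r` previous queries
together with the labels that the oracle predicted for them. -/
structure Adversary (X : Type) [MeasurableSpace X] (n : ℕ) where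
  Seed : Type
  [seedSpace : MeasurableSpace Seed]
  law : Measure Seed
  [isProb : IsProbabilityMeasure law]
  choose : (r : ℕ) → Seed × (Fin n → X × Bool) × (Fin r → X × Bool) → X
  measurable_choose : ∀ r, Measurable (choose r)

attribute [instance] Adversary.seedSpace Adversary.isProb

section Game

variable {X : Type} [MeasurableSpace X]

/-- The random choices of the prediction game: the `n` unlabeled training points, the fresh points
and the coins of all rounds, the tape of the oracle, and the seed of the adversary. -/
abbrev Outcome (O : PredictionOracle X) {n : ℕ} (F : Adversary X n) : Type :=
  (Fin n → X) × (ℕ → X) × (ℕ → Bool) × O.Tape × F.Seed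

/-- All the choices are independent. The training points and the fresh points have law `D`, and every
coin is `true` with probability `γ` (which is meant to lie in `[0, 1]`). -/
def gameMeasure (O : PredictionOracle X) {n : ℕ} (F : Adversary X n) (D : Measure X)
    [IsProbabilityMeasure D] (γ : ℝ) : Measure (Outcome O F) :=
  (Measure.pi fun _ : Fin n => D).prod <|
    (Measure.infinitePi fun _ : ℕ => D).prod <|
      (Measure.infinitePi fun _ : ℕ =>
        bernoulliMeasure true false (Set.projIcc (0 : ℝ) 1 zero_le_one γ)).prod <|
          O.law.prod F.law

/-- The training set, labeled by the target concept. -/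
def trainingSet {O : PredictionOracle X} {n : ℕ} {F : Adversary X n} (c : X → Bool)
    (ω : Outcome O F) : Fin n → X × Bool :=
  fun k => (ω.1 k, c (ω.1 k))

/-- The first `r` queries together with the predicted labels. If the coin of a round is `true`, then
the query is the fresh point of that round; otherwise the adversary chooses it. -/
def transcript (O : PredictionOracle X) {n : ℕ} (F : Adversary X n) (c : X → Bool)
    (ω : Outcome O F) : (r : ℕ) → Fin r → X × Bool
  | 0 => Fin.elim0
  | r + 1 =>
    let T : Fin r → X × Bool := transcript O F c ω r
    let x : X := if ω.2.2.1 r then ω.2.1 r else F.choose r (ω.2.2.2.2, trainingSet c ω, T)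
    Fin.snoc (α := fun _ => X × Bool) T
      (x, O.hyp ω.2.2.2.1 (trainingSet c ω) (fun k => (T k).1) x)

/-- The hypothesis `h_r` held by the oracle after `r` rounds of the game. -/
def hypothesis (O : PredictionOracle X) {n : ℕ} (F : Adversary X n) (c : X → Bool)
    (ω : Outcome O F) (r : ℕ) : X → Bool :=
  O.hyp ω.2.2.2.1 (trainingSet c ω) (fun k => (transcript O F c ω r k).1)

/-- The generalization error `Pr_{x ∼ D}[h x ≠ c x]`. -/
def error (D : Measure X) (c h : X → Bool) : ENNReal := D {x | h x ≠ c x}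

/-- The requirement of `(α, β, γ, n)`-everlasting robust prediction for the target concept `c` and
the target distribution `D`: against every adversary, the probability that some hypothesis
`h_0, h_1, …` has error above `α` is at most `β`. -/
def IsEverlastingRobustPredictorFor (O : PredictionOracle X) (α β γ : ℝ) (n : ℕ)
    (c : X → Bool) (D : Measure X) [IsProbabilityMeasure D] : Prop :=
  ∀ F : Adversary X n,
    gameMeasure O F D γ {ω | ∃ r : ℕ, ENNReal.ofReal α < error D c (hypothesis O F c ω r)}
      ≤ ENNReal.ofReal β

end Game

/-! ### Axis-aligned rectangles -/

abbrev Point (d : ℕ) : Type := Fin d → ℝ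

open Classical in
/-- The concept of the rectangle `∏ j, [a j, b j]`. -/
def rectangle {d : ℕ} (a b : Point d) : Point d → Bool :=
  fun x => decide (∀ j, a j ≤ x j ∧ x j ≤ b j)

/-- The class of all axis-aligned rectangles over `ℝ^d`. -/
def REC (d : ℕ) : Set (Point d → Bool) := {c | ∃ a b : Point d, c = rectangle a b}

/-! ### Noise -/

/-- The Laplace distribution with scale `1`; if `ξ` has this law then `b * ξ` has law `Lap(b)`. -/
def stdLaplace : Measure ℝ :=
  volume.withDensity fun x => ENNReal.ofReal (Real.exp (-|x|) / 2)

instance : IsProbabilityMeasure stdLaplace := by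
  constructor
  have h1 : ∫ x : ℝ, Real.exp (-|x|) / 2 = 1 := by
    rw [integral_div, integral_comp_abs (f := fun x => Real.exp (-x)), integral_exp_neg_Ioi_zero]
    norm_num
  have hi : Integrable fun x : ℝ => Real.exp (-|x|) / 2 := by
    by_contra h
    rw [integral_undef h] at h1
    exact zero_ne_one h1
  rw [stdLaplace, withDensity_apply _ MeasurableSet.univ, Measure.restrict_univ,
    ← ofReal_integral_eq_lintegral_ofReal hi (Filter.Eventually.of_forall fun x => by positivity),
    h1, ENNReal.ofReal_one]

/-! ### `Stopper`, `BetweenThresholds` and `ChallengeBT` -/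

/-- The scale of the Laplace noise of `Stopper` with privacy parameters `ε, δ`. -/
def stopperScale (ε δ : ℝ) : ℝ := 8 / ε * Real.log (2 / δ)

/-- The scale of the Laplace noise of `BetweenThresholds` with privacy parameters `ε, δ` and with
`k` "medium" reports. -/
def btScale (ε δ k : ℝ) : ℝ := 4 / ε * Real.sqrt (k * Real.log (2 / δ))

/-- In `ChallengeBT` with parameters `ε, δ, k` and time bound `T`, the (never halting) copy of
`BetweenThresholds` is run with parameters `ε, δ / 2` and this number of "medium" reports. -/
def challengeK (ε δ k T : ℝ) : ℝ := k + 8 / ε * Real.log (2 / δ) * Real.log (T / δ)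

inductive Answer where
  | low
  | medium
  | high

open Classical in
/-- The answer of `BetweenThresholds` to a query of value `f`, where `noise` is the Laplace noise. -/
def btAnswer (tl th f noise : ℝ) : Answer :=
  if f + noise < tl then .low else if th < f + noise then .high else .medium

/-- The state of a copy of `ChallengeBT`: the dataset it was executed on, and the sum of the bits fed
so far to its `Stopper`, that is, the number of its "medium" answers. The flag of `ChallengeBT`,
which makes it ignore a second query between two stopping queries, is not recorded:
`RectanglesPERP` never poses such a second query. -/
structure ChallengeBT (d : ℕ) where
  data : List (Point d)
  ones : ℕ

/-! ### The parameters of `RectanglesPERP` -/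

/-- The input parameters of the algorithm, and the constants `cδ, aδ, cm, ct, cΔ` hidden in the
asymptotic notation of the derived parameters below. -/
structure Params where
  (ε δstar α β γ : ℝ)
  (cδ cm ct cΔ : ℝ)
  aδ : ℕ

namespace Params

/-- `α_p = α / 2 ^ p`. -/
def alpha (P : Params) (p : ℕ) : ℝ := P.α / 2 ^ p

/-- `β_p = β / 2 ^ p`. -/
def beta (P : Params) (p : ℕ) : ℝ := P.β / 2 ^ p

/-- The main term `Q = δ* γ α ε² β / (d 8^p)` of `δ_p`. -/
def deltaMain (P : Params) (d p : ℕ) : ℝ :=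
  P.δstar * P.γ * P.α * P.ε ^ 2 * P.β / (d * 8 ^ p)

/-- `δ_p = cδ · Q / log(1 / Q) ^ aδ`. -/
def delta (P : Params) (d p : ℕ) : ℝ :=
  P.cδ * P.deltaMain d p / Real.log (1 / P.deltaMain d p) ^ P.aδ

/-- `m_p = cm · ε⁻² · log(d / (α_p β_p γ ε δ_p)) ^ 5`, rounded up. -/
def m (P : Params) (d p : ℕ) : ℕ :=
  ⌈P.cm / P.ε ^ 2 *
    Real.log (d / (P.alpha p * P.beta p * P.γ * P.ε * P.delta d p)) ^ 5⌉₊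

/-- `k_p = 2 m_p`. -/
def k (P : Params) (d p : ℕ) : ℕ := 2 * P.m d p

/-- `t_p = ct · d · m_p / (γ α_p)`, rounded up. -/
def t (P : Params) (d p : ℕ) : ℕ := ⌈P.ct * d * P.m d p / (P.γ * P.alpha p)⌉₊

/-- `Δ_p = cΔ · (log(1 / δ_p) / ε) · √(k_p log(d / δ_p)) · log(d t_p / β_p)`. -/
def threshold (P : Params) (d p : ℕ) : ℝ :=
  P.cΔ * (Real.log (1 / P.delta d p) / P.ε) *
    Real.sqrt (P.k d p * Real.log (d / P.delta d p)) * Real.log (d * P.t d p / P.beta p)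

/-- The first privacy parameter `ε / log(1 / δ_p)` of the copies of `ChallengeBT` in phase `p`. -/
def copyEps (P : Params) (d p : ℕ) : ℝ := P.ε / Real.log (1 / P.delta d p)

/-- The second privacy parameter `δ_p / d` of the copies of `ChallengeBT` in phase `p`. -/
def copyDelta (P : Params) (d p : ℕ) : ℝ := P.delta d p / d

/-- The scale of the noise of a stopping query in phase `p`. -/
def stopNoise (P : Params) (d p : ℕ) : ℝ := stopperScale (P.copyEps d p) (P.copyDelta d p)

/-- The scale of the noise of a `BetweenThresholds` query in phase `p`. -/
def btNoise (P : Params) (d p : ℕ) : ℝ :=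
  btScale (P.copyEps d p) (P.copyDelta d p / 2)
    (challengeK (P.copyEps d p) (P.copyDelta d p) (P.k d p) (P.t d p))

end Params

/-! ### Algorithm `RectanglesPERP` -/

inductive Side where
  | left
  | right
  deriving DecidableEq

/-- The names of the copies of `ChallengeBT`: `(j, left)` is `Left_j` and `(j, right)` is
`Right_j`. -/
abbrev Idx (d : ℕ) : Type := Fin d × Side

/-- The random tape of the algorithm: for every round and every copy the (unscaled) Laplace noise of
the stopping query and that of the `BetweenThresholds` query, and for every phase and every copy the
geometric noise of `RSC`. -/
abbrev Tape (d : ℕ) : Type := (ℕ × Idx d → ℝ) × (ℕ × Idx d → ℝ) × (ℕ × Idx d → ℕ)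

/-- All the noises are independent; the geometric noises of phase `p` have law
`Geom(1 - exp(-ε / log(1 / δ_p)))`. -/
def tapeLaw (P : Params) (d : ℕ) : Measure (Tape d) :=
  (Measure.infinitePi fun _ : ℕ × Idx d => stdLaplace).prod <|
    (Measure.infinitePi fun _ : ℕ × Idx d => stdLaplace).prod <|
      Measure.infinitePi fun q : ℕ × Idx d =>
        geometricMeasure (Set.projIcc (0 : ℝ) 1 zero_le_one (1 - Real.exp (-P.copyEps d q.1)))

instance (P : Params) (d : ℕ) : IsProbabilityMeasure (tapeLaw P d) := by
  unfold tapeLaw; infer_instance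

open Classical in
/-- Order the points so that those with extreme `j`th coordinate come first: the smallest ones for
`(j, left)`, the largest ones for `(j, right)`. -/
def extremeFirst {d : ℕ} (q : Idx d) (L : List (Point d)) : List (Point d) :=
  match q.2 with
  | .left => L.insertionSort fun x y => x q.1 ≤ y q.1
  | .right => L.insertionSort fun x y => y q.1 ≤ x q.1

/-- `RSC`: for each requested copy `q` in turn, the slice of `q` consists of the `size q` most extreme
points of the remaining dataset, and it is removed from the dataset. -/
def rsc {d : ℕ} (size : Idx d → ℕ) : List (Idx d) → List (Point d) → Idx d → List (Point d)
  | [], _ => fun _ => []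
  | q :: qs, L =>
    Function.update (rsc size qs ((extremeFirst q L).drop (size q))) q
      ((extremeFirst q L).take (size q))

/-- `RSC` serves `Right_1, Left_1, Right_2, Left_2, …` in this order. -/
def rscOrder (d : ℕ) : List (Idx d) :=
  (List.finRange d).flatMap fun j => [(j, Side.right), (j, Side.left)]

/-- Queries are tested against `Left_1, Right_1, Left_2, Right_2, …` in this order. -/
def testOrder (d : ℕ) : List (Idx d) :=
  (List.finRange d).flatMap fun j => [(j, Side.left), (j, Side.right)]

/-- The state of the algorithm: the current phase `p`, the number of completed rounds, the copies of
`ChallengeBT`, the dataset `D`, and the datasets `D_j^left`, `D_j^right`. -/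
structure State (d : ℕ) where
  phase : ℕ
  time : ℕ
  copy : Idx d → ChallengeBT d
  D : List (Point d × Bool)
  side : Idx d → List (Point d)

/-- Begin phase `p`: use `RSC` on the positive examples of the dataset `L` to execute the copies of
`ChallengeBT`, the copy `q` on the `m_p + Geom` most extreme points. -/
def startPhase (P : Params) {d : ℕ} (tape : Tape d) (p time : ℕ) (L : List (Point d × Bool)) :
    State d where
  phase := p
  time := time
  copy q :=
    ⟨rsc (fun q => P.m d p + tape.2.2 (p, q)) (rscOrder d)
      ((L.filter fun e => e.2).map Prod.fst) q, 0⟩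
  D := []
  side _ := []

/-- The copy `q` halts at the stopping query that is posed at the beginning of the current round. -/
def Halts (P : Params) {d : ℕ} (tape : Tape d) (s : State d) (q : Idx d) : Prop :=
  (P.k d s.phase : ℝ) ≤ P.stopNoise d s.phase * tape.1 (s.time, q) + (s.copy q).ones

open Classical in
/-- The beginning of a round: pose a stopping query to every copy; a copy that halts is re-executed
on the corresponding dataset `D_j^left` or `D_j^right`, which is then emptied. -/
def beginRound (P : Params) {d : ℕ} (tape : Tape d) (s : State d) : State d :=
  { s with
    copy := fun q => if Halts P tape s q then ⟨s.side q, 0⟩ else s.copy q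
    side := fun q => if Halts P tape s q then [] else s.side q }

open Classical in
/-- The number of points in the dataset of the copy `q` whose `j`th coordinate is bigger (for
`Left_j`) or smaller (for `Right_j`) than that of the query point `x`. -/
def countBeyond {d : ℕ} (s : State d) (q : Idx d) (x : Point d) : ℕ :=
  match q.2 with
  | .left => (s.copy q).data.countP fun y => decide (x q.1 < y q.1)
  | .right => (s.copy q).data.countP fun y => decide (y q.1 < x q.1)

/-- The answer of the copy `q` to the query point `x` in the current round, with the thresholds
`t_l = Δ_p` and `t_h = 2 Δ_p`. -/
def answer (P : Params) {d : ℕ} (tape : Tape d) (s : State d) (x : Point d) (q : Idx d) : Answer :=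
  btAnswer (P.threshold d s.phase) (2 * P.threshold d s.phase) (countBeyond s q x)
    (P.btNoise d s.phase * tape.2.1 (s.time, q))

/-- The result of the tests of a query: a "high" answer, a "medium" answer of the copy `q`, or "low"
answers only. -/
inductive TestResult (d : ℕ) where
  | high
  | medium (q : Idx d)
  | allLow

/-- Query the copies one after the other, until an answer is not "low". -/
def runTests {d : ℕ} (ans : Idx d → Answer) : List (Idx d) → TestResult d
  | [] => .allLow
  | q :: qs =>
    match ans q with
    | .high => .high
    | .medium => .medium q
    | .low => runTests ans qs

/-- The result of the tests of the query point `x`, where `s` is the state after the stopping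
queries of the round. -/
def test (P : Params) {d : ℕ} (tape : Tape d) (s : State d) (x : Point d) : TestResult d :=
  runTests (answer P tape s x) (testOrder d)

/-- The predicted label: it is `1` iff all the answers are "low". -/
def TestResult.label {d : ℕ} : TestResult d → Bool
  | .allLow => true
  | _ => false

/-- Process the query point `x` after the stopping queries of the round: a "medium" answer of the copy
`q` adds `x` to the dataset `D_j^left` or `D_j^right` of `q` (and a `1` to its `Stopper`); otherwise
`x` is added to `D` with its predicted label. -/
def processQuery (P : Params) {d : ℕ} (tape : Tape d) (s : State d) (x : Point d) : State d :=
  match test P tape s x with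
  | .medium q =>
    { s with
      copy := Function.update s.copy q ⟨(s.copy q).data, (s.copy q).ones + 1⟩
      side := Function.update s.side q (x :: s.side q) }
  | r => { s with D := (x, r.label) :: s.D }

/-- The end of a round: if it was the round `t_1 + … + t_p`, then begin the next phase on the
dataset `D`. -/
def endRound (P : Params) {d : ℕ} (tape : Tape d) (s : State d) : State d :=
  if s.time + 1 = ∑ p ∈ Finset.Icc 1 s.phase, P.t d p then
    startPhase P tape (s.phase + 1) (s.time + 1) s.D
  else { s with time := s.time + 1 }

/-- One round of the algorithm; `none` is the symbol `⊥` for "no query". -/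
def round (P : Params) {d : ℕ} (tape : Tape d) (s : State d) : Option (Point d) → State d
  | none => endRound P tape (beginRound P tape s)
  | some x => endRound P tape (processQuery P tape (beginRound P tape s) x)

/-- The state after the algorithm has received the dataset `S` and the queries `x`. -/
def runState (P : Params) {d : ℕ} (tape : Tape d) (S : List (Point d × Bool))
    (x : List (Option (Point d))) : State d :=
  x.foldl (round P tape) (startPhase P tape 1 0 S)

/-- Algorithm `RectanglesPERP` in dimension `d`, as a prediction oracle. Its hypothesis after `r`
rounds maps a point `y` to the label which would be predicted for `y` in round `r + 1`, with the
noises of that round. -/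
def RectanglesPERP (P : Params) (d : ℕ) : PredictionOracle (Point d) where
  Tape := Tape d
  law := tapeLaw P d
  hyp := fun tape _ S _ x y =>
    (test P tape
      (beginRound P tape (runState P tape (List.ofFn S) (List.ofFn fun k => some (x k)))) y).label

end

end PERP

/-!
Write `outward q x` for the coordinate of `x` towards the face of the rectangle guarded by the copy
`q`. The copy counts how many points of its dataset lie less far out than the query, so a query
which is beyond no stored point has count `0`, and a query outside of the rectangle in direction
`q` is beyond the whole dataset, provided that the dataset lies inside the rectangle in that
direction.

All the randomness is isolated in one event (`Favourable`): every noise of phase `p` is below its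
threshold, and whenever the difference of two boxes has measure above `α_p / 2`, it receives more
fresh points in phase `p` than `RSC` removes at the beginning of phase `p + 1` (and similarly for
the training set). As this speaks about all boxes at the same time, it depends neither on the
adversary nor on the history of the game. Its probability is bounded by approximating boxes from a
finite grid of quantiles (`measure_exists_region_le`), a union bound over this grid, and Markov's
inequality for `2 ^ (-count)` (`measure_card_le`).

On this event everything is deterministic (`Invariant`). In each phase there is a box of safe
points, beyond none of the points stored by the copies. Stored points remain inside the rectangle,
since a "medium" count is far below the size `m_p` of a dataset. They also remain beyond the safe
points, since a "medium" answer needs a positive count. So safe points are always labeled `1`,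
points outside of the rectangle are always labeled `0`, and the error is at most the measure of the
unsafe part of the rectangle. When a new phase begins, all the fresh safe points have been
collected with the label `1`, and those which become unsafe have been removed by `RSC`. There are
too few of them for the safe box to lose more than measure `α_{p+1}` (`startPhase_sound`). The
losses add up to less than `α`.

The derived parameters are compared by means of the common logarithm `ell`, which at most doubles
from one phase to the next; `Admissible` lists what is needed of the hidden constants.
-/

namespace PERP

/-! ### Outwardness and the slices of `RSC` -/

/-- The coordinate of `x` in the direction of the copy `q`, signed so that it grows towards the
face of the rectangle which `q` guards: `-x j` for `Left_j` and `x j` for `Right_j`. -/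
def outward {d : ℕ} (q : Idx d) (x : Point d) : ℝ :=
  match q.2 with
  | .left => -x q.1
  | .right => x q.1

theorem measurable_outward {d : ℕ} (q : Idx d) : Measurable (outward q) := by
  rcases q with ⟨j, _ | _⟩
  · exact (measurable_pi_apply j).neg
  · exact measurable_pi_apply j

open Classical in
theorem countBeyond_eq {d : ℕ} (s : State d) (q : Idx d) (x : Point d) :
    countBeyond s q x =
      (s.copy q).data.countP fun y => decide (outward q y < outward q x) := by
  rcases q with ⟨j, _ | _⟩
  · exact List.countP_congr fun y _ => by simp [outward]
  · exact List.countP_congr fun y _ => (decide_eq_true_iff (p := y j < x j)).trans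
      (decide_eq_true_iff (p := y j < x j)).symm

theorem extremeFirst_perm {d : ℕ} (q : Idx d) (L : List (Point d)) :
    (extremeFirst q L).Perm L := by
  rcases q with ⟨j, _ | _⟩
  · exact List.perm_insertionSort _ _
  · exact List.perm_insertionSort _ _

theorem extremeFirst_pairwise {d : ℕ} (q : Idx d) (L : List (Point d)) :
    (extremeFirst q L).Pairwise fun x y => outward q y ≤ outward q x := by
  classical
  rcases q with ⟨j, _ | _⟩
  · have : Std.Total fun x y : Point d => x j ≤ y j := ⟨fun x y => le_total _ _⟩
    have : IsTrans (Point d) fun x y : Point d => x j ≤ y j := ⟨fun x y z h h' => h.trans h'⟩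
    simpa [extremeFirst, outward] using
      List.pairwise_insertionSort (fun x y : Point d => x j ≤ y j) L
  · have : Std.Total fun x y : Point d => y j ≤ x j := ⟨fun x y => le_total _ _⟩
    have : IsTrans (Point d) fun x y : Point d => y j ≤ x j := ⟨fun x y z h h' => h'.trans h⟩
    simpa [extremeFirst, outward] using
      List.pairwise_insertionSort (fun x y : Point d => y j ≤ x j) L

theorem mem_of_mem_rsc {d : ℕ} (size : Idx d → ℕ) (qs : List (Idx d)) :
    ∀ (L : List (Point d)) (q : Idx d) (y : Point d), y ∈ rsc size qs L q → y ∈ L := by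
  induction qs with
  | nil => intro L q y h; simp [rsc] at h
  | cons q₀ qs ih =>
    intro L q y h
    rw [rsc] at h
    rcases eq_or_ne q q₀ with rfl | hq
    · rw [Function.update_self] at h
      exact (extremeFirst_perm q L).mem_iff.1 (List.mem_of_mem_take h)
    · rw [Function.update_of_ne hq] at h
      exact (extremeFirst_perm q₀ L).mem_iff.1 (List.mem_of_mem_drop (ih _ _ _ h))

theorem length_rsc {d : ℕ} (size : Idx d → ℕ) (qs : List (Idx d)) :
    ∀ L : List (Point d), (qs.map size).sum ≤ L.length → ∀ q ∈ qs,
      (rsc size qs L q).length = size q := by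
  induction qs with
  | nil => intro L _ q h; simp at h
  | cons q₀ qs ih =>
    intro L hL q hq
    rw [List.map_cons, List.sum_cons] at hL
    have hlen := (extremeFirst_perm q₀ L).length_eq
    rw [rsc]
    rcases eq_or_ne q q₀ with rfl | hne
    · rw [Function.update_self, List.length_take]
      omega
    · rw [Function.update_of_ne hne]
      refine ih _ ?_ q ((List.mem_cons.1 hq).resolve_left hne)
      rw [List.length_drop]
      omega

open Classical in
/-- Only points which are themselves removed can lie strictly further out than some removed point,
so there are at most as many of them as there are requested points. -/
theorem countP_beyond_rsc_le {d : ℕ} (size : Idx d → ℕ) (qs : List (Idx d)) :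
    ∀ L : List (Point d), qs.Nodup →
      (L.countP fun x => decide (∃ q ∈ qs, ∃ y ∈ rsc size qs L q, outward q y < outward q x))
        ≤ (qs.map size).sum := by
  induction qs with
  | nil => intro L _; simp
  | cons q₀ qs ih =>
    intro L hnd
    rw [List.nodup_cons] at hnd
    set E := extremeFirst q₀ L with hE
    have hsorted : ∀ x ∈ E.drop (size q₀), ∀ y ∈ E.take (size q₀), outward q₀ x ≤ outward q₀ y := by
      intro x hx y hy
      have h := extremeFirst_pairwise q₀ L
      rw [← hE, ← List.take_append_drop (size q₀) E, List.pairwise_append] at h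
      exact h.2.2 y hy x hx
    rw [← (extremeFirst_perm q₀ L).countP_eq, ← hE]
    conv_lhs => rw [← List.take_append_drop (size q₀) E]
    rw [List.countP_append, List.map_cons, List.sum_cons]
    refine add_le_add (List.countP_le_length.trans (by rw [List.length_take]; omega)) ?_
    refine le_trans (List.countP_mono_left ?_) (ih (E.drop (size q₀)) hnd.2)
    intro x hx h
    rw [decide_eq_true_eq] at h ⊢
    obtain ⟨q, hq, y, hy, hxy⟩ := h
    rw [rsc, ← hE] at hy
    rcases eq_or_ne q q₀ with rfl | hne
    · rw [Function.update_self] at hy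
      exact absurd (hsorted x hx y hy) (not_le.2 hxy)
    · rw [Function.update_of_ne hne] at hy
      exact ⟨q, (List.mem_cons.1 hq).resolve_left hne, y, hy, hxy⟩

theorem mem_rscOrder {d : ℕ} (q : Idx d) : q ∈ rscOrder d := by
  rcases q with ⟨j, _ | _⟩ <;> simp [rscOrder]

theorem mem_testOrder {d : ℕ} (q : Idx d) : q ∈ testOrder d := by
  rcases q with ⟨j, _ | _⟩ <;> simp [testOrder]

theorem nodup_rscOrder (d : ℕ) : (rscOrder d).Nodup := by
  rw [rscOrder, List.nodup_flatMap]
  refine ⟨fun j _ => by simp, ?_⟩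
  refine (List.nodup_finRange d).imp ?_
  intro i j hij
  simp [Function.onFun, List.disjoint_left, hij]

theorem length_rscOrder (d : ℕ) : (rscOrder d).length = 2 * d := by
  simp [rscOrder, List.length_flatMap, mul_comm]

theorem sum_size_le {d : ℕ} (size : Idx d → ℕ) (N : ℕ) (h : ∀ q, size q ≤ N) :
    ((rscOrder d).map size).sum ≤ 2 * d * N := by
  have := List.sum_le_card_nsmul ((rscOrder d).map size) N (by
    simp only [List.mem_map]
    rintro _ ⟨q, _, rfl⟩
    exact h q)
  simpa [length_rscOrder] using this

/-! ### Answers of the tests -/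

theorem runTests_eq_allLow {d : ℕ} {ans : Idx d → Answer} {qs : List (Idx d)} :
    runTests ans qs = .allLow ↔ ∀ q ∈ qs, ans q = .low := by
  induction qs with
  | nil => simp [runTests]
  | cons q qs ih =>
    rw [runTests]
    cases h : ans q <;> simp [h, ih]

theorem ans_eq_medium_of_runTests {d : ℕ} {ans : Idx d → Answer} {qs : List (Idx d)} {q : Idx d}
    (h : runTests ans qs = .medium q) : ans q = .medium := by
  induction qs with
  | nil => simp [runTests] at h
  | cons q₀ qs ih =>
    rw [runTests] at h
    cases h₀ : ans q₀ <;> simp [h₀] at h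
    · exact ih h
    · exact h ▸ h₀

theorem test_eq_allLow {P : Params} {d : ℕ} {tape : Tape d} {s : State d} {x : Point d} :
    test P tape s x = .allLow ↔ ∀ q, answer P tape s x q = .low := by
  rw [test, runTests_eq_allLow]
  exact ⟨fun h q => h q (mem_testOrder q), fun h q _ => h q⟩

theorem label_eq_true {d : ℕ} {r : TestResult d} : r.label = true ↔ r = .allLow := by
  cases r <;> simp [TestResult.label]

/-! ### Boxes -/

instance : Fintype Side := ⟨{.left, .right}, fun s => by cases s <;> simp⟩

theorem card_idx (d : ℕ) : Fintype.card (Idx d) = 2 * d := by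
  rw [Fintype.card_prod, Fintype.card_fin, mul_comm]
  rfl

/-- The points whose outwardness in every direction `q` lies in `A q`. When all the `A q` are lower
sets, this is an axis-aligned box whose faces may be open, closed or at infinity. -/
def region {d : ℕ} (A : Idx d → Set ℝ) : Set (Point d) := {x | ∀ q, outward q x ∈ A q}

theorem measurableSet_region {d : ℕ} {A : Idx d → Set ℝ} (hA : ∀ q, IsLowerSet (A q)) :
    MeasurableSet (region A) := by
  have : region A = ⋂ q, outward q ⁻¹' A q := by ext; simp [region]
  rw [this]
  exact MeasurableSet.iInter fun q => measurable_outward q (hA q).ordConnected.measurableSet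

/-- The outwardness of the faces of the rectangle `∏ j, [a j, b j]`. -/
def faces {d : ℕ} (a b : Point d) (q : Idx d) : ℝ :=
  match q.2 with
  | .left => -a q.1
  | .right => b q.1

theorem rectangle_eq_true {d : ℕ} {a b x : Point d} :
    rectangle a b x = true ↔ x ∈ region fun q => Set.Iic (faces a b q) := by
  simp only [rectangle, decide_eq_true_eq, region, Set.mem_ofPred_eq, Set.mem_Iic]
  constructor
  · rintro h ⟨j, _ | _⟩
    · simpa [outward, faces] using (h j).1
    · simpa [outward, faces] using (h j).2
  · intro h j
    exact ⟨by simpa [outward, faces] using h (j, .left), by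
      simpa [outward, faces] using h (j, .right)⟩

/-! ### The invariant within a phase -/

/-- The state `s` is sound for the rectangle with faces `b` and for the set `G` of safe points: all
stored points lie inside the rectangle in their respective direction, no safe point lies strictly
further out than a stored point, and the datasets of all copies have at least `m_p` points. -/
structure Sound (P : Params) {d : ℕ} (b : Idx d → ℝ) (G : Set (Point d)) (s : State d) : Prop where
  data_le : ∀ q, ∀ y ∈ (s.copy q).data, outward q y ≤ b q
  side_le : ∀ q, ∀ y ∈ s.side q, outward q y ≤ b q
  le_data : ∀ x ∈ G, ∀ q, ∀ y ∈ (s.copy q).data, outward q x ≤ outward q y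
  le_side : ∀ x ∈ G, ∀ q, ∀ y ∈ s.side q, outward q x ≤ outward q y
  length_data : ∀ q, P.m d s.phase ≤ (s.copy q).data.length
  length_side : ∀ q, (s.side q).length = (s.copy q).ones

/-- In the round with index `r`, the noises with the scales of phase `p` are small: those of the
stopping queries are at most `m_p`, and those of the `BetweenThresholds` queries are below `Δ_p`.
-/
def SmallNoise (P : Params) {d : ℕ} (tape : Tape d) (p r : ℕ) : Prop :=
  ∀ q : Idx d, |P.stopNoise d p * tape.1 (r, q)| ≤ P.m d p ∧
    |P.btNoise d p * tape.2.1 (r, q)| < P.threshold d p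

section Round

variable {P : Params} {d : ℕ} {tape : Tape d} {b : Idx d → ℝ} {G : Set (Point d)} {s : State d}

/-- A copy halts only after at least `k_p - m_p = m_p` "medium" answers, so its new dataset is
again large. -/
theorem Sound.beginRound (h : Sound P b G s) (hn : SmallNoise P tape s.phase s.time) :
    Sound P b G (beginRound P tape s) := by
  have hhalt : ∀ q, Halts P tape s q → P.m d s.phase ≤ (s.side q).length := by
    intro q hq
    have h1 := (abs_le.1 (hn q).1).2
    rw [Halts, Params.k] at hq
    rw [h.length_side q]
    push_cast at hq
    exact_mod_cast (by linarith : (P.m d s.phase : ℝ) ≤ (s.copy q).ones)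
  constructor
  · intro q y hy
    by_cases hq : Halts P tape s q
    · exact h.side_le q y (by simpa [PERP.beginRound, hq] using hy)
    · exact h.data_le q y (by simpa [PERP.beginRound, hq] using hy)
  · intro q y hy
    by_cases hq : Halts P tape s q
    · simp [PERP.beginRound, hq] at hy
    · exact h.side_le q y (by simpa [PERP.beginRound, hq] using hy)
  · intro x hx q y hy
    by_cases hq : Halts P tape s q
    · exact h.le_side x hx q y (by simpa [PERP.beginRound, hq] using hy)
    · exact h.le_data x hx q y (by simpa [PERP.beginRound, hq] using hy)
  · intro x hx q y hy
    by_cases hq : Halts P tape s q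
    · simp [PERP.beginRound, hq] at hy
    · exact h.le_side x hx q y (by simpa [PERP.beginRound, hq] using hy)
  · intro q
    by_cases hq : Halts P tape s q
    · simpa [PERP.beginRound, hq] using hhalt q hq
    · simpa [PERP.beginRound, hq] using h.length_data q
  · intro q
    by_cases hq : Halts P tape s q
    · simp [PERP.beginRound, hq]
    · simpa [PERP.beginRound, hq] using h.length_side q

theorem Sound.answer_eq_low (h : Sound P b G s) (hn : SmallNoise P tape s.phase s.time)
    {x : Point d} (hx : x ∈ G) (q : Idx d) : answer P tape s x q = .low := by
  classical
  have h0 : countBeyond s q x = 0 := by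
    rw [countBeyond_eq, List.countP_eq_zero]
    intro y hy
    simpa using h.le_data x hx q y hy
  have h1 := (abs_lt.1 (hn q).2).2
  rw [answer, btAnswer, if_pos (by rw [h0]; push_cast; linarith)]

/-- A point outside the rectangle in the direction `q` lies beyond the whole dataset of `q`, so
that its count is above `3Δ_p`. -/
theorem Sound.answer_eq_high (h : Sound P b G s) (hn : SmallNoise P tape s.phase s.time)
    (hm : 3 * P.threshold d s.phase ≤ P.m d s.phase) {x : Point d} {q : Idx d}
    (hx : b q < outward q x) : answer P tape s x q = .high := by
  classical
  have h0 : countBeyond s q x = (s.copy q).data.length := by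
    rw [countBeyond_eq, List.countP_eq_length]
    intro y hy
    simpa using (h.data_le q y hy).trans_lt hx
  have h1 := abs_lt.1 (hn q).2
  have h2 : (P.m d s.phase : ℝ) ≤ (s.copy q).data.length := by exact_mod_cast h.length_data q
  rw [answer, btAnswer, h0, if_neg (by linarith), if_pos (by linarith)]

theorem Sound.test_of_mem (h : Sound P b G s) (hn : SmallNoise P tape s.phase s.time)
    {x : Point d} (hx : x ∈ G) : test P tape s x = .allLow :=
  test_eq_allLow.2 fun q => h.answer_eq_low hn hx q

theorem Sound.outward_le_of_allLow (h : Sound P b G s) (hn : SmallNoise P tape s.phase s.time)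
    (hm : 3 * P.threshold d s.phase ≤ P.m d s.phase) {x : Point d}
    (hx : test P tape s x = .allLow) (q : Idx d) : outward q x ≤ b q := by
  by_contra hq
  have h1 := test_eq_allLow.1 hx q
  rw [h.answer_eq_high hn hm (not_le.1 hq)] at h1
  cases h1

theorem Sound.processQuery (h : Sound P b G s) (hn : SmallNoise P tape s.phase s.time)
    (hm : 3 * P.threshold d s.phase ≤ P.m d s.phase) (x : Point d) :
    Sound P b G (processQuery P tape s x) := by
  classical
  rcases hr : test P tape s x with _ | q₀ | _
  · rw [PERP.processQuery, hr]; exact ⟨h.1, h.2, h.3, h.4, h.5, h.6⟩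
  · have hmed : answer P tape s x q₀ = .medium := ans_eq_medium_of_runTests hr
    have hxb : outward q₀ x ≤ b q₀ := by
      by_contra hq
      rw [h.answer_eq_high hn hm (not_le.1 hq)] at hmed
      cases hmed
    -- A "medium" answer forces a positive count, so `x` lies beyond some stored point.
    have hxG : ∀ w ∈ G, outward q₀ w ≤ outward q₀ x := by
      intro w hw
      have hpos : countBeyond s q₀ x ≠ 0 := by
        intro h0
        have h1 := (abs_lt.1 (hn q₀).2).2
        rw [answer, btAnswer, if_pos (by rw [h0]; push_cast; linarith)] at hmed
        cases hmed
      rw [countBeyond_eq, ← Nat.pos_iff_ne_zero, List.countP_pos_iff] at hpos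
      obtain ⟨y, hy, hyx⟩ := hpos
      exact (h.le_data w hw q₀ y hy).trans (of_decide_eq_true hyx).le
    have hcopy : ∀ q, ((PERP.processQuery P tape s x).copy q).data = (s.copy q).data := by
      intro q
      rw [PERP.processQuery, hr]
      rcases eq_or_ne q q₀ with rfl | hq <;> simp [*]
    have hside : ∀ q, ∀ y ∈ (PERP.processQuery P tape s x).side q,
        y ∈ s.side q ∨ (q = q₀ ∧ y = x) := by
      intro q y hy
      rw [PERP.processQuery, hr] at hy
      rcases eq_or_ne q q₀ with rfl | hq
      · simp at hy; tauto
      · simp [hq] at hy; tauto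
    have hphase : (PERP.processQuery P tape s x).phase = s.phase := by
      rw [PERP.processQuery, hr]
    constructor
    · intro q y hy
      rw [hcopy] at hy
      exact h.data_le q y hy
    · intro q y hy
      rcases hside q y hy with hy | ⟨rfl, rfl⟩
      exacts [h.side_le q y hy, hxb]
    · intro w hw q y hy
      rw [hcopy] at hy
      exact h.le_data w hw q y hy
    · intro w hw q y hy
      rcases hside q y hy with hy | ⟨rfl, rfl⟩
      exacts [h.le_side w hw q y hy, hxG w hw]
    · intro q
      rw [hcopy, hphase]
      exact h.length_data q
    · intro q
      rw [PERP.processQuery, hr]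
      rcases eq_or_ne q q₀ with rfl | hq
      · simpa using h.length_side q
      · simpa [hq] using h.length_side q
  · rw [PERP.processQuery, hr]; exact ⟨h.1, h.2, h.3, h.4, h.5, h.6⟩

/-- Safe points lie in the rectangle. -/
theorem Sound.subset (h : Sound P b G s) (hm : 0 < P.m d s.phase) :
    G ⊆ region fun q => Set.Iic (b q) := by
  intro x hx q
  obtain ⟨y, hy⟩ := List.exists_mem_of_length_pos (hm.trans_le (h.length_data q))
  exact (h.le_data x hx q y hy).trans (h.data_le q y hy)

/-- The current hypothesis is correct on the safe points and outside of the rectangle. -/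
theorem Sound.label_eq (h : Sound P b G s) (hn : SmallNoise P tape s.phase s.time)
    (hm : 3 * P.threshold d s.phase ≤ P.m d s.phase) {x : Point d}
    (hx : x ∉ (region fun q => Set.Iic (b q)) \ G) :
    (test P tape s x).label = true ↔ x ∈ region fun q => Set.Iic (b q) := by
  rw [label_eq_true]
  constructor
  · intro ht q
    exact h.outward_le_of_allLow hn hm ht q
  · intro hc
    exact h.test_of_mem hn (by by_contra hG; exact hx ⟨hc, hG⟩)

end Round

/-! ### The beginning of a phase -/

open Classical in
/-- Suppose that the dataset `L` contains, with the label `1`, at least `N R` points of every part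
`R` of the box `A'`, where `N` is large on every difference of boxes of measure above `η`. Then the
new copies are sound for a new box which covers `A'` up to measure `η`: the points of `L` in the
rest of `A'` have all been removed by `RSC`. -/
theorem startPhase_sound {P : Params} {d : ℕ} (hd : 1 ≤ d) (tape : Tape d) (p time : ℕ)
    (L : List (Point d × Bool)) (b : Idx d → ℝ) (A' : Idx d → Set ℝ)
    (μ : Measure (Point d)) (η : ℝ) (N : Set (Point d) → ℕ)
    (hL : ∀ e ∈ L, e.2 = true → ∀ q, outward q e.1 ≤ b q)
    (hN : ∀ R ⊆ region A', N R ≤ L.countP fun e => decide (e.2 = true ∧ e.1 ∈ R))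
    (hgeom : ∀ q, tape.2.2 (p, q) ≤ P.m d p)
    (hunif : ∀ A : Idx d → Set ℝ, (∀ q, IsLowerSet (A q)) →
      η < μ.real (region A' \ region A) → 2 * d * (2 * P.m d p) < N (region A' \ region A))
    (hA' : η < μ.real (region A')) :
    ∃ A : Idx d → Set ℝ, (∀ q, IsLowerSet (A q)) ∧
      Sound P b (region A) (startPhase P tape p time L) ∧
      μ.real (region A' \ region A) ≤ η := by
  set Q : List (Point d) := (L.filter fun e => e.2).map Prod.fst with hQ
  set size : Idx d → ℕ := fun q => P.m d p + tape.2.2 (p, q) with hsize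
  have hsum : ((rscOrder d).map size).sum ≤ 2 * d * (2 * P.m d p) :=
    sum_size_le _ _ fun q => by have := hgeom q; simp only [hsize]; omega
  have hcount : ∀ R : Set (Point d), (L.countP fun e => decide (e.2 = true ∧ e.1 ∈ R)) =
      Q.countP fun x => decide (x ∈ R) := by
    intro R
    rw [hQ, List.countP_map, List.countP_filter]
    exact List.countP_congr fun e _ => by simp [and_comm]
  have hQb : ∀ x ∈ Q, ∀ q, outward q x ≤ b q := by
    intro x hx q
    simp only [hQ, List.mem_map, List.mem_filter] at hx
    obtain ⟨e, ⟨he, he2⟩, rfl⟩ := hx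
    exact hL e he he2 q
  have hlen : ((rscOrder d).map size).sum ≤ Q.length := by
    have hempty : region (fun _ : Idx d => (∅ : Set ℝ)) = ∅ := by
      ext x
      simp only [region, Set.mem_ofPred_eq, Set.mem_empty_iff_false, iff_false, not_forall]
      exact ⟨(⟨0, hd⟩, .left), id⟩
    have h1 := hunif (fun _ => ∅) (fun _ => isLowerSet_empty)
    rw [hempty, Set.sdiff_empty] at h1
    have h2 := hN _ subset_rfl
    rw [hcount] at h2
    have h3 : Q.countP (fun x => decide (x ∈ region A')) ≤ Q.length := List.countP_le_length
    have h4 := h1 hA'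
    omega
  set A : Idx d → Set ℝ := fun q => {v | ∀ y ∈ rsc size (rscOrder d) Q q, v ≤ outward q y} with hA
  have hAl : ∀ q, IsLowerSet (A q) := fun q v w hwv hv y hy => hwv.trans (hv y hy)
  refine ⟨A, hAl, ⟨?_, ?_, ?_, ?_, ?_, ?_⟩, ?_⟩
  · intro q y hy
    exact hQb y (mem_of_mem_rsc _ _ _ _ _ hy) q
  · intro q y hy
    simp [startPhase] at hy
  · intro x hx q y hy
    exact hx q y hy
  · intro x hx q y hy
    simp [startPhase] at hy
  · intro q
    change P.m d p ≤ (rsc size (rscOrder d) Q q).length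
    rw [length_rsc size _ _ hlen q (mem_rscOrder q)]
    exact Nat.le_add_right _ _
  · intro q
    rfl
  · by_contra hlt
    have h1 := hunif A hAl (not_le.1 hlt)
    have h2 := hN (region A' \ region A) Set.sdiff_subset
    rw [hcount] at h2
    have h3 := countP_beyond_rsc_le size (rscOrder d) Q (nodup_rscOrder d)
    obtain ⟨R, hR⟩ : ∃ R, R = region A' \ region A := ⟨_, rfl⟩
    rw [← hR] at h1 h2
    have h4 : (Q.countP fun x => decide (x ∈ R)) ≤
        Q.countP fun x => decide (∃ q ∈ rscOrder d, ∃ y ∈ rsc size (rscOrder d) Q q,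
          outward q y < outward q x) := by
      refine List.countP_mono_left fun x _ hx => ?_
      rw [decide_eq_true_eq] at hx ⊢
      have h5 := (hR ▸ hx).2
      simp only [region, hA, Set.mem_ofPred_eq, not_forall, not_le] at h5
      obtain ⟨q, y, hy, hxy⟩ := h5
      exact ⟨q, mem_rscOrder q, y, hy, hxy⟩
    omega

/-! ### The invariant across phases -/

/-- The number of rounds up to the end of phase `p`. -/
noncomputable def finish (P : Params) (d p : ℕ) : ℕ := ∑ i ∈ Finset.Icc 1 p, P.t d i

theorem finish_succ (P : Params) (d p : ℕ) : finish P d (p + 1) = finish P d p + P.t d (p + 1) :=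
  Finset.sum_Icc_succ_top (by omega) _

open Classical in
/-- The number of rounds of phase `p + 1`, among the first `r` rounds, which pose a fresh point of
`R`. -/
noncomputable def freshCount (P : Params) (d : ℕ) (z : ℕ → Point d) (coin : ℕ → Bool) (p r : ℕ)
    (R : Set (Point d)) : ℕ :=
  ((Finset.Ico (finish P d p) r).filter fun i => coin i = true ∧ z i ∈ R).card

open Classical in
theorem freshCount_mono {P : Params} {d : ℕ} (z : ℕ → Point d) (coin : ℕ → Bool) (p r : ℕ) :
    Monotone (freshCount P d z coin p r) := fun _ _ hR =>
  Finset.card_le_card (Finset.monotone_filter_right _ fun _ _ hi => ⟨hi.1, hR hi.2⟩)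

/-- The derived parameters fit together: phases are not empty, and the thresholds are well below the
sizes of the datasets. -/
structure Fit (P : Params) (d : ℕ) : Prop where
  t_pos : ∀ p, 1 ≤ p → 0 < P.t d p
  m_pos : ∀ p, 1 ≤ p → 0 < P.m d p
  threshold_le : ∀ p, 1 ≤ p → 3 * P.threshold d p ≤ P.m d p

open Classical in
/-- The number of training points in `R`. -/
noncomputable def sampleCount {d n : ℕ} (S : Fin n → Point d) (R : Set (Point d)) : ℕ :=
  (Finset.univ.filter fun k => S k ∈ R).card

open Classical in
theorem sampleCount_mono {d n : ℕ} (S : Fin n → Point d) : Monotone (sampleCount S) :=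
  fun _ _ hR => Finset.card_le_card (Finset.monotone_filter_right _ fun _ _ hi => hR hi)

/-- The random choices are favourable: all noises are small, and every difference of two boxes which
is not tiny receives many points of the training set and many fresh points of every phase. -/
structure Favourable (P : Params) {d n : ℕ} (μ : Measure (Point d)) (tape : Tape d)
    (S : Fin n → Point d) (z : ℕ → Point d) (coin : ℕ → Bool) : Prop where
  noise : ∀ p, ∀ r ∈ Finset.Ico (finish P d p) (finish P d (p + 1)), SmallNoise P tape (p + 1) r
  geom : ∀ p q, tape.2.2 (p + 1, q) ≤ P.m d (p + 1)
  sample : ∀ A' A : Idx d → Set ℝ, (∀ q, IsLowerSet (A' q)) → (∀ q, IsLowerSet (A q)) →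
    P.alpha 1 < μ.real (region A' \ region A) →
    2 * d * (2 * P.m d 1) < sampleCount S (region A' \ region A)
  fresh : ∀ p, ∀ A' A : Idx d → Set ℝ, (∀ q, IsLowerSet (A' q)) → (∀ q, IsLowerSet (A q)) →
    P.alpha (p + 2) < μ.real (region A' \ region A) →
    2 * d * (2 * P.m d (p + 2)) <
      freshCount P d z coin p (finish P d (p + 1)) (region A' \ region A)

open Classical in
/-- The state `s` after `r` rounds, where the current phase is `p + 1`: it is sound for a box which
misses at most measure `α_1 + … + α_{p+1}` of the rectangle, and the fresh points in this box seen
in the current phase have been collected with the label `1`. -/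
structure Invariant (P : Params) {d : ℕ} (b : Idx d → ℝ) (μ : Measure (Point d))
    (z : ℕ → Point d) (coin : ℕ → Bool) (r p : ℕ) (A : Idx d → Set ℝ) (s : State d) : Prop where
  sound : Sound P b (region A) s
  lower : ∀ q, IsLowerSet (A q)
  measure_le : μ.real ((region fun q => Set.Iic (b q)) \ region A) ≤ P.α * (1 - 1 / 2 ^ (p + 1))
  phase_eq : s.phase = p + 1
  time_eq : s.time = r
  start_le : finish P d p ≤ r
  lt_finish : r < finish P d (p + 1)
  D_le : ∀ e ∈ s.D, e.2 = true → ∀ q, outward q e.1 ≤ b q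
  count_le : ∀ R ⊆ region A,
    freshCount P d z coin p r R ≤ s.D.countP fun e => decide (e.2 = true ∧ e.1 ∈ R)

section Run

variable {P : Params} {d n : ℕ} {b : Idx d → ℝ} {μ : Measure (Point d)}
  {tape : Tape d} {S : Fin n → Point d} {z : ℕ → Point d} {coin : ℕ → Bool}

theorem freshCount_self (p : ℕ) (R : Set (Point d)) :
    freshCount P d z coin p (finish P d p) R = 0 := by
  simp [freshCount]

open Classical in
theorem exists_invariant_zero (hd : 1 ≤ d) (hfit : Fit P d) (hα : 0 < P.α)
    (hμ : P.α < μ.real (region fun q => Set.Iic (b q))) (hfav : Favourable P μ tape S z coin)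
    (c : Point d → Bool) (hc : ∀ x, c x = true ↔ x ∈ region fun q => Set.Iic (b q)) :
    ∃ A, Invariant P b μ z coin 0 0 A
      (startPhase P tape 1 0 (List.ofFn fun k => (S k, c (S k)))) := by
  have hlow : ∀ q, IsLowerSet (Set.Iic (b q)) := fun q => isLowerSet_Iic _
  obtain ⟨A, hAl, hs, hA⟩ := startPhase_sound hd tape 1 0 (List.ofFn fun k => (S k, c (S k))) b
    (fun q => Set.Iic (b q)) μ (P.alpha 1) (sampleCount S)
    (by
      intro e he h2 q
      obtain ⟨k, rfl⟩ := (List.mem_ofFn' _ _).1 he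
      exact (hc _).1 h2 q)
    (by
      intro R hR
      have h1 : ((List.ofFn fun k => (S k, c (S k))).countP fun e =>
          decide (e.2 = true ∧ e.1 ∈ R)) =
          (Finset.univ.filter fun k => c (S k) = true ∧ S k ∈ R).card := by
        rw [List.ofFn_eq_map, List.countP_map, Finset.card_def, Finset.filter_val, Fin.univ_def,
          ← Multiset.countP_eq_card_filter, Multiset.coe_countP]
        rfl
      rw [h1, sampleCount]
      refine Finset.card_le_card fun k hk => ?_
      rw [Finset.mem_filter] at hk ⊢
      exact ⟨hk.1, (hc _).2 (hR hk.2), hk.2⟩)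
    (hfav.geom 0) (fun A hA h => hfav.sample _ A hlow hA h)
    (by rw [Params.alpha]; linarith)
  refine ⟨A, hs, hAl, ?_, rfl, rfl, by simp [finish], ?_, by simp [startPhase], ?_⟩
  · refine hA.trans (le_of_eq ?_)
    rw [Params.alpha]; ring
  · rw [finish_succ]
    have := hfit.t_pos 1 le_rfl
    simpa using Or.inr this
  · intro R _
    simp [freshCount]

theorem Invariant.smallNoise (hfav : Favourable P μ tape S z coin) {r p : ℕ} {A : Idx d → Set ℝ}
    {s : State d} (h : Invariant P b μ z coin r p A s) : SmallNoise P tape s.phase s.time := by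
  rw [h.phase_eq, h.time_eq]
  exact hfav.noise p r (Finset.mem_Ico.2 ⟨h.start_le, h.lt_finish⟩)

open Classical in
/-- The invariant is preserved by a round whose query is the fresh point whenever the coin says so.
-/
theorem Invariant.round [IsFiniteMeasure μ] (hd : 1 ≤ d) (hfit : Fit P d) (hα : 0 < P.α)
    (hμ : P.α < μ.real (region fun q => Set.Iic (b q))) (hfav : Favourable P μ tape S z coin)
    {r p : ℕ} {A : Idx d → Set ℝ} {s : State d} (h : Invariant P b μ z coin r p A s)
    {x : Point d} (hx : coin r = true → x = z r) :
    ∃ p' A', Invariant P b μ z coin (r + 1) p' A' (round P tape s (some x)) := by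
  have hn := h.smallNoise hfav
  have hp : 1 ≤ s.phase := by rw [h.phase_eq]; omega
  have hs₁ := h.sound.beginRound hn
  have hth := hfit.threshold_le _ hp
  set s₁ := beginRound P tape s with hs₁_def
  have hn₁ : SmallNoise P tape s₁.phase s₁.time := hn
  have hs₂ := hs₁.processQuery hn₁ hth x
  set s₂ := processQuery P tape s₁ x with hs₂_def
  have hphase₂ : s₂.phase = p + 1 := by
    rw [← h.phase_eq, hs₂_def, processQuery]
    split <;> rfl
  have htime₂ : s₂.time = r := by
    rw [← h.time_eq, hs₂_def, processQuery]
    split <;> rfl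
  have hD₂ : ∀ e ∈ s₂.D, e ∈ s.D ∨ e = (x, (test P tape s₁ x).label) := by
    intro e he
    rw [hs₂_def, processQuery] at he
    split at he
    · exact Or.inl he
    · rcases List.mem_cons.1 he with he | he
      exacts [Or.inr he, Or.inl he]
  have hDle : ∀ e ∈ s₂.D, e.2 = true → ∀ q, outward q e.1 ≤ b q := by
    intro e he h2 q
    rcases hD₂ e he with he | rfl
    · exact h.D_le e he h2 q
    · exact hs₁.outward_le_of_allLow hn₁ hth (label_eq_true.1 h2) q
  have hcount : ∀ R ⊆ region A, freshCount P d z coin p (r + 1) R ≤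
      s₂.D.countP fun e => decide (e.2 = true ∧ e.1 ∈ R) := by
    intro R hR
    have h0 := h.count_le R hR
    have hins : Finset.Ico (finish P d p) (r + 1) = insert r (Finset.Ico (finish P d p) r) :=
      (Finset.insert_Ico_right_eq_Ico_add_one h.start_le).symm
    by_cases hr : coin r = true ∧ z r ∈ R
    · have hxz := hx hr.1
      have ht : test P tape s₁ x = .allLow := hs₁.test_of_mem hn₁ (hxz ▸ hR hr.2)
      have hD : s₂.D = (x, true) :: s.D := by
        rw [hs₂_def, processQuery, ht]; rfl
      rw [hD, List.countP_cons_of_pos (by simpa [hxz] using hr.2)]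
      refine le_trans ?_ (Nat.add_le_add_right h0 1)
      rw [freshCount, hins, Finset.filter_insert, if_pos hr]
      exact Finset.card_insert_le _ _
    · have h1 : freshCount P d z coin p (r + 1) R = freshCount P d z coin p r R := by
        rw [freshCount, hins, Finset.filter_insert, if_neg hr]; rfl
      rw [h1]
      refine h0.trans ?_
      rw [hs₂_def, processQuery]
      split
      · exact le_rfl
      · exact (List.sublist_cons_self _ _).countP_le
  have hround : PERP.round P tape s (some x) = endRound P tape s₂ := rfl
  rw [hround, endRound]
  by_cases hend : s₂.time + 1 = ∑ p ∈ Finset.Icc 1 s₂.phase, P.t d p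
  · rw [if_pos hend, hphase₂, htime₂]
    rw [hphase₂, htime₂] at hend
    have hfin : finish P d (p + 1) = r + 1 := hend.symm
    have hsub := h.sound.subset (hfit.m_pos _ hp)
    have hpow : (0 : ℝ) < 2 ^ (p + 1) := by positivity
    obtain ⟨A', hAl', hs', hA'⟩ := startPhase_sound hd tape (p + 2) (r + 1) s₂.D b A μ
      (P.alpha (p + 2)) (freshCount P d z coin p (r + 1)) hDle hcount (hfav.geom (p + 1))
      (fun A' hA' hlt => by
        have := hfav.fresh p A A' h.lower hA' hlt
        rwa [hfin] at this)
      (by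
        have h1 := measureReal_sdiff_add_inter (μ := μ)
          (s := region fun q => Set.Iic (b q)) (measurableSet_region h.lower)
        rw [Set.inter_eq_right.2 hsub] at h1
        have h2 := h.measure_le
        have h3 : P.alpha (p + 2) < P.α * (1 / 2 ^ (p + 1)) := by
          rw [Params.alpha, pow_succ _ (p + 1), div_eq_mul_one_div]
          gcongr
          linarith
        linarith)
    refine ⟨p + 1, A', hs', hAl', ?_, rfl, rfl, hfin.le, ?_, by simp [startPhase], ?_⟩
    · have h1 : ((region fun q => Set.Iic (b q)) \ region A') ⊆
          ((region fun q => Set.Iic (b q)) \ region A) ∪ (region A \ region A') := by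
        intro w hw
        by_cases hwA : w ∈ region A
        exacts [Or.inr ⟨hwA, hw.2⟩, Or.inl ⟨hw.1, hwA⟩]
      have h2 := (measureReal_mono (μ := μ) h1).trans (measureReal_union_le _ _)
      refine h2.trans ((add_le_add h.measure_le hA').trans (le_of_eq ?_))
      rw [Params.alpha]
      field_simp
      ring
    · rw [finish_succ, hfin]
      have := hfit.t_pos (p + 2) (by omega)
      change r + 1 < r + 1 + P.t d (p + 2)
      omega
    · intro R _
      rw [← hfin, freshCount_self]
      exact Nat.zero_le _
  · rw [if_neg hend]
    rw [hphase₂, htime₂] at hend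
    refine ⟨p, A, ⟨hs₂.1, hs₂.2, hs₂.3, hs₂.4, hs₂.5, hs₂.6⟩, h.lower, h.measure_le, hphase₂,
      ?_, ?_, ?_, hDle, hcount⟩
    · change s₂.time + 1 = r + 1
      rw [htime₂]
    · exact h.start_le.trans (Nat.le_succ r)
    · have := h.lt_finish
      change ¬ (r + 1 = finish P d (p + 1)) at hend
      omega

open Classical in
/-- Under favourable random choices, the error is at most `α` at all times. -/
theorem measure_error_le [IsFiniteMeasure μ] (hd : 1 ≤ d) (hfit : Fit P d) (hα : 0 < P.α)
    (hμ : P.α < μ.real (region fun q => Set.Iic (b q))) (hfav : Favourable P μ tape S z coin)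
    (c : Point d → Bool) (hc : ∀ x, c x = true ↔ x ∈ region fun q => Set.Iic (b q))
    (x : ℕ → Point d) (hx : ∀ r, coin r = true → x r = z r) (r : ℕ) :
    error μ c ((RectanglesPERP P d).hyp tape (fun k => (S k, c (S k))) fun k : Fin r => x k)
      ≤ ENNReal.ofReal P.α := by
  have hinv : ∀ r : ℕ, ∃ p A, Invariant P b μ z coin r p A
      (runState P tape (List.ofFn fun k => (S k, c (S k)))
        (List.ofFn fun k : Fin r => some (x k))) := by
    intro r
    induction r with
    | zero =>
      obtain ⟨A, hA⟩ := exists_invariant_zero hd hfit hα hμ hfav c hc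
      exact ⟨0, A, hA⟩
    | succ r ih =>
      obtain ⟨p, A, h⟩ := ih
      obtain ⟨p', A', h'⟩ := h.round hd hfit hα hμ hfav (hx r)
      refine ⟨p', A', ?_⟩
      rw [List.ofFn_succ', runState, List.concat_eq_append, List.foldl_append]
      exact h'
  obtain ⟨p, A, h⟩ := hinv r
  have hn := h.smallNoise hfav
  have hth := hfit.threshold_le (p + 1) (Nat.succ_pos p)
  rw [← h.phase_eq] at hth
  have hs := h.sound.beginRound hn
  have hsub : {y | (RectanglesPERP P d).hyp tape (fun k => (S k, c (S k)))
      (fun k : Fin r => x k) y ≠ c y} ⊆ (region fun q => Set.Iic (b q)) \ region A := by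
    intro y hy
    by_contra hyA
    refine hy ?_
    have h1 := hs.label_eq hn hth hyA
    rw [← hc] at h1
    exact Bool.eq_iff_iff.2 h1
  refine (measure_mono hsub).trans ?_
  rw [← ofReal_measureReal]
  refine ENNReal.ofReal_le_ofReal (h.measure_le.trans ?_)
  have : (0 : ℝ) < 1 / 2 ^ (p + 1) := by positivity
  nlinarith

end Run

/-! ### Finite grids of lower sets -/

section Grid

variable (ν : Measure ℝ) (M : ℕ)

/-- The half-lines which approximate lower sets from inside, up to measure `1 / M`. -/
def innerGrid (i : ℕ) : Set ℝ := {x | ν.real (Set.Iio x) < (i : ℝ) / M}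

/-- The half-lines which approximate lower sets from outside, up to measure `1 / M`. -/
def outerGrid (i : ℕ) : Set ℝ := {x | ν.real (Set.Iic x) ≤ (i : ℝ) / M}

variable [IsProbabilityMeasure ν]

theorem isLowerSet_innerGrid (i : ℕ) : IsLowerSet (innerGrid ν M i) := fun _ _ h hx =>
  (measureReal_mono (Set.Iio_subset_Iio h)).trans_lt hx

theorem isLowerSet_outerGrid (i : ℕ) : IsLowerSet (outerGrid ν M i) := fun _ _ h hx =>
  (measureReal_mono (Set.Iic_subset_Iic.2 h)).trans hx

theorem measureReal_le_of_isCompact {U : Set ℝ} (hU : MeasurableSet U) {s : ℝ} (hs : 0 ≤ s)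
    (h : ∀ K ⊆ U, IsCompact K → K.Nonempty → ν.real K ≤ s) : ν.real U ≤ s := by
  refine ENNReal.toReal_le_of_le_ofReal hs ?_
  rw [hU.measure_eq_iSup_isCompact]
  refine iSup_le fun K => iSup_le fun hK => iSup_le fun hc => ?_
  rcases K.eq_empty_or_nonempty with rfl | hne
  · simp
  · rw [← ofReal_measureReal]
    exact ENNReal.ofReal_le_ofReal (h K hK hc hne)

theorem measureReal_outerGrid_le (i : ℕ) : ν.real (outerGrid ν M i) ≤ (i : ℝ) / M := by
  refine measureReal_le_of_isCompact ν (isLowerSet_outerGrid ν M i).ordConnected.measurableSet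
    (by positivity) fun K hK hc hne => ?_
  obtain ⟨x, hx, hmax⟩ := hc.exists_isGreatest hne
  exact (measureReal_mono fun y hy => hmax hy).trans (hK hx)

theorem le_measureReal_innerGrid {i : ℕ} (hM : 0 < M) (hi : i ≤ M) :
    (i : ℝ) / M ≤ ν.real (innerGrid ν M i) := by
  have hmeas := (isLowerSet_innerGrid ν M i).ordConnected.measurableSet
  have hiM : (i : ℝ) / M ≤ 1 := by
    rw [div_le_one (by exact_mod_cast hM)]
    exact_mod_cast hi
  have h : ν.real (innerGrid ν M i)ᶜ ≤ 1 - (i : ℝ) / M := by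
    refine measureReal_le_of_isCompact ν hmeas.compl (by linarith) fun K hK hc hne => ?_
    obtain ⟨x, hx, hmin⟩ := hc.exists_isLeast hne
    have h1 : (i : ℝ) / M ≤ ν.real (Set.Iio x) := not_lt.1 (hK hx)
    have h2 := probReal_compl_eq_one_sub (μ := ν) (measurableSet_Iio (a := x))
    rw [Set.compl_Iio] at h2
    have h3 : ν.real K ≤ ν.real (Set.Ici x) := measureReal_mono fun y hy => hmin hy
    linarith
  rw [probReal_compl_eq_one_sub hmeas] at h
  linarith

theorem exists_innerGrid (hM : 0 < M) {A : Set ℝ} (hA : IsLowerSet A) :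
    ∃ i ≤ M, innerGrid ν M i ⊆ A ∧ ν.real (A \ innerGrid ν M i) ≤ 1 / M := by
  have hM' : (0 : ℝ) < M := by exact_mod_cast hM
  set i := ⌊M * ν.real A⌋₊ with hi
  have h0 : 0 ≤ M * ν.real A := by positivity
  have h1 : (i : ℝ) / M ≤ ν.real A := by
    rw [div_le_iff₀ hM', mul_comm]
    exact Nat.floor_le h0
  have h2 : ν.real A < (i + 1 : ℝ) / M := by
    rw [lt_div_iff₀ hM', mul_comm]
    exact Nat.lt_floor_add_one _
  have hiM : i ≤ M := by
    refine Nat.floor_le_of_le ?_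
    exact mul_le_of_le_one_right hM'.le measureReal_le_one
  have hsub : innerGrid ν M i ⊆ A := by
    intro x hx
    by_contra hxA
    have h3 : A ⊆ Set.Iio x := fun y hy => lt_of_not_ge fun hxy => hxA (hA hxy hy)
    have h4 : ν.real (Set.Iio x) < (i : ℝ) / M := hx
    have h5 : ν.real A ≤ ν.real (Set.Iio x) := measureReal_mono h3
    linarith
  refine ⟨i, hiM, hsub, ?_⟩
  rw [measureReal_sdiff hsub (isLowerSet_innerGrid ν M i).ordConnected.measurableSet]
  have h6 := le_measureReal_innerGrid ν M hM hiM
  rw [add_div] at h2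
  linarith

theorem exists_outerGrid (hM : 0 < M) {A : Set ℝ} (hA : IsLowerSet A) :
    ∃ i ≤ M, A ⊆ outerGrid ν M i ∧ ν.real (outerGrid ν M i \ A) ≤ 1 / M := by
  have hM' : (0 : ℝ) < M := by exact_mod_cast hM
  set i := ⌈M * ν.real A⌉₊ with hi
  have h0 : 0 ≤ M * ν.real A := by positivity
  have h1 : ν.real A ≤ (i : ℝ) / M := by
    rw [le_div_iff₀ hM', mul_comm]
    exact Nat.le_ceil _
  have h2 : (i : ℝ) / M < ν.real A + 1 / M := by
    rw [← sub_lt_iff_lt_add, ← sub_div, div_lt_iff₀ hM', mul_comm]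
    linarith [Nat.ceil_lt_add_one h0]
  have hiM : i ≤ M := Nat.ceil_le.2 (mul_le_of_le_one_right hM'.le measureReal_le_one)
  have hsub : A ⊆ outerGrid ν M i := fun x hx =>
    (measureReal_mono fun y hy => hA hy hx : ν.real (Set.Iic x) ≤ ν.real A).trans h1
  refine ⟨i, hiM, hsub, ?_⟩
  rw [measureReal_sdiff hsub hA.ordConnected.measurableSet]
  have h6 := measureReal_outerGrid_le ν M i
  linarith

end Grid

/-! ### Uniform convergence for differences of boxes -/

section Uniform

variable {d : ℕ} (μ : Measure (Point d)) [IsProbabilityMeasure μ]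

instance (q : Idx d) : IsProbabilityMeasure (μ.map (outward q)) :=
  Measure.isProbabilityMeasure_map (measurable_outward q).aemeasurable

/-- Every difference of two boxes contains one from a finite family, of nearly the same measure. -/
theorem exists_grid_subset {M : ℕ} (hM : 0 < M) {A' A : Idx d → Set ℝ}
    (hA' : ∀ q, IsLowerSet (A' q)) (hA : ∀ q, IsLowerSet (A q)) :
    ∃ i o : Idx d → Fin (M + 1),
      region (fun q => innerGrid (μ.map (outward q)) M (i q)) \
        region (fun q => outerGrid (μ.map (outward q)) M (o q)) ⊆ region A' \ region A ∧
      μ.real (region A' \ region A) ≤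
        μ.real (region (fun q => innerGrid (μ.map (outward q)) M (i q)) \
          region (fun q => outerGrid (μ.map (outward q)) M (o q))) + 4 * d / M := by
  choose i hi hi1 hi2 using fun q => exists_innerGrid (μ.map (outward q)) M hM (hA' q)
  choose o ho ho1 ho2 using fun q => exists_outerGrid (μ.map (outward q)) M hM (hA q)
  refine ⟨fun q => ⟨i q, Nat.lt_succ_of_le (hi q)⟩, fun q => ⟨o q, Nat.lt_succ_of_le (ho q)⟩,
    ?_, ?_⟩
  · exact Set.sdiff_subset_sdiff (fun x hx q => hi1 q (hx q)) (fun x hx q => ho1 q (hx q))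
  · set R := region (fun q => innerGrid (μ.map (outward q)) M (i q)) \
      region (fun q => outerGrid (μ.map (outward q)) M (o q)) with hR
    set E : Idx d → Set (Point d) := fun q =>
      outward q ⁻¹' (A' q \ innerGrid (μ.map (outward q)) M (i q)) ∪
        outward q ⁻¹' (outerGrid (μ.map (outward q)) M (o q) \ A q) with hE
    have hsub : region A' \ region A ⊆ R ∪ ⋃ q, E q := by
      intro x hx
      by_cases h1 : ∀ q, outward q x ∈ innerGrid (μ.map (outward q)) M (i q)
      · by_cases h2 : ∀ q, outward q x ∈ outerGrid (μ.map (outward q)) M (o q)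
        · have h3 := hx.2
          simp only [region, Set.mem_ofPred_eq, not_forall] at h3
          obtain ⟨q, hq⟩ := h3
          exact Or.inr (Set.mem_iUnion.2 ⟨q, Or.inr ⟨h2 q, hq⟩⟩)
        · exact Or.inl ⟨h1, h2⟩
      · rw [not_forall] at h1
        obtain ⟨q, hq⟩ := h1
        exact Or.inr (Set.mem_iUnion.2 ⟨q, Or.inl ⟨hx.1 q, hq⟩⟩)
    have hEq : ∀ q, μ.real (E q) ≤ 2 / M := by
      intro q
      have h1 := hi2 q
      have h2 := ho2 q
      rw [map_measureReal_apply (measurable_outward q) ((hA' q).ordConnected.measurableSet.diff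
        (isLowerSet_innerGrid _ M _).ordConnected.measurableSet)] at h1
      rw [map_measureReal_apply (measurable_outward q)
        ((isLowerSet_outerGrid _ M _).ordConnected.measurableSet.diff
          (hA q).ordConnected.measurableSet)] at h2
      refine (measureReal_union_le _ _).trans ((add_le_add h1 h2).trans (le_of_eq ?_))
      ring
    refine (measureReal_mono hsub).trans ((measureReal_union_le _ _).trans ?_)
    gcongr
    refine (measureReal_iUnion_fintype_le _).trans ((Finset.sum_le_sum fun q _ => hEq q).trans ?_)
    rw [Finset.sum_const, Finset.card_univ, card_idx, nsmul_eq_mul]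
    push_cast
    apply le_of_eq
    ring

/-- A bound on the probability that a monotone count is small on a given set of measure at least
`η / 2` extends to all differences of boxes of measure above `η`, by a union bound over the grid. -/
theorem measure_exists_region_le {Ω : Type*} [MeasurableSpace Ω] (Q : Measure Ω)
    (N : Ω → Set (Point d) → ℕ) (hN : ∀ ω, Monotone (N ω)) (κ : ℕ) {η : ℝ} {M : ℕ} (hM : 0 < M)
    (hη : 8 * d / η ≤ M) (hη0 : 0 < η) (δ : ENNReal)
    (h : ∀ R : Set (Point d), MeasurableSet R → η / 2 ≤ μ.real R → Q {ω | N ω R ≤ κ} ≤ δ) :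
    Q {ω | ∃ A' A : Idx d → Set ℝ, (∀ q, IsLowerSet (A' q)) ∧ (∀ q, IsLowerSet (A q)) ∧
      η < μ.real (region A' \ region A) ∧ N ω (region A' \ region A) ≤ κ}
      ≤ ((M + 1 : ℕ) : ENNReal) ^ (4 * d) * δ := by
  classical
  set R : (Idx d → Fin (M + 1)) × (Idx d → Fin (M + 1)) → Set (Point d) := fun t =>
    region (fun q => innerGrid (μ.map (outward q)) M (t.1 q)) \
      region (fun q => outerGrid (μ.map (outward q)) M (t.2 q)) with hR
  have hsub : {ω | ∃ A' A : Idx d → Set ℝ, (∀ q, IsLowerSet (A' q)) ∧ (∀ q, IsLowerSet (A q)) ∧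
      η < μ.real (region A' \ region A) ∧ N ω (region A' \ region A) ≤ κ} ⊆
      ⋃ t, {ω | η / 2 ≤ μ.real (R t) ∧ N ω (R t) ≤ κ} := by
    rintro ω ⟨A', A, hA', hA, hlt, hle⟩
    obtain ⟨i, o, hsub, hmes⟩ := exists_grid_subset μ hM hA' hA
    refine Set.mem_iUnion.2 ⟨(i, o), ?_, (hN ω hsub).trans hle⟩
    have h1 : 4 * (d : ℝ) / M ≤ η / 2 := by
      have hM' : (0 : ℝ) < M := by exact_mod_cast hM
      rw [div_le_iff₀ hη0] at hη
      rw [div_le_iff₀ hM']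
      linarith
    have h2 : μ.real (R (i, o)) = μ.real (region (fun q => innerGrid (μ.map (outward q)) M (i q)) \
          region (fun q => outerGrid (μ.map (outward q)) M (o q))) := rfl
    rw [h2]
    linarith
  have hmeas : ∀ t, MeasurableSet (R t) := fun t =>
    (measurableSet_region fun q => isLowerSet_innerGrid _ M _).diff
      (measurableSet_region fun q => isLowerSet_outerGrid _ M _)
  refine (measure_mono hsub).trans ((measure_iUnion_fintype_le _ _).trans ?_)
  have hterm : ∀ t, Q {ω | η / 2 ≤ μ.real (R t) ∧ N ω (R t) ≤ κ} ≤ δ := by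
    intro t
    by_cases ht : η / 2 ≤ μ.real (R t)
    · exact (measure_mono fun ω hω => hω.2).trans (h _ (hmeas t) ht)
    · simp [ht]
  refine (Finset.sum_le_sum fun t _ => hterm t).trans ?_
  rw [Finset.sum_const, Finset.card_univ, Fintype.card_prod, Fintype.card_fun, Fintype.card_fin,
    card_idx, nsmul_eq_mul, ← pow_add]
  push_cast
  rw [show 2 * d + 2 * d = 4 * d by ring]

end Uniform

/-! ### Lower tails of counts -/

theorem lintegral_prod_infinitePi {ι X : Type*} [MeasurableSpace X] (ν : ι → Measure X)
    [∀ i, IsProbabilityMeasure (ν i)] (I : Finset ι) (g : ι → X → ENNReal)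
    (hg : ∀ i, Measurable (g i)) :
    ∫⁻ x, ∏ i ∈ I, g i (x i) ∂(Measure.infinitePi ν) = ∏ i ∈ I, ∫⁻ x, g i x ∂(ν i) := by
  refine (lintegral_prod_eq_prod_lintegral_of_indepFun I (fun i (x : ι → X) => g i (x i))
    (iIndepFun_infinitePi hg) (fun i => (hg i).comp (measurable_pi_apply i))).trans ?_
  refine Finset.prod_congr rfl fun i _ => ?_
  exact (measurePreserving_eval_infinitePi ν i).lintegral_comp (hg i)

open Classical in
theorem lintegral_half_le {X : Type*} [MeasurableSpace X] (ν : Measure X) [IsProbabilityMeasure ν]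
    {R : Set X} (hR : MeasurableSet R) :
    ∫⁻ x, (if x ∈ R then 2⁻¹ else 1) ∂ν = ENNReal.ofReal (1 - ν.real R / 2) := by
  have h1 : (fun x => if x ∈ R then (2⁻¹ : ENNReal) else 1) =
      fun x => R.indicator (fun _ => 2⁻¹) x + Rᶜ.indicator (fun _ => 1) x := by
    ext x
    by_cases hx : x ∈ R <;> simp [hx]
  rw [h1, lintegral_add_left (measurable_const.indicator hR), lintegral_indicator_const hR,
    lintegral_indicator_const hR.compl, ← ofReal_measureReal, ← ofReal_measureReal (s := Rᶜ),
    probReal_compl_eq_one_sub hR, one_mul,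
    show (2⁻¹ : ENNReal) = ENNReal.ofReal 2⁻¹ by rw [ENNReal.ofReal_inv_of_pos two_pos]; simp,
    ← ENNReal.ofReal_mul (by norm_num), ← ENNReal.ofReal_add (by positivity)
      (sub_nonneg.2 measureReal_le_one)]
  congr 1
  ring

/-- Markov's inequality for `2 ^ (-count)`. -/
theorem measure_card_le {Ω ι : Type*} [MeasurableSpace Ω] (Q : Measure Ω) (I : Finset ι)
    (B : ι → Ω → Prop) [∀ i ω, Decidable (B i ω)] (κ : ℕ) (E : ENNReal)
    (hE : ∫⁻ ω, ∏ i ∈ I, (if B i ω then 2⁻¹ else 1) ∂Q ≤ E)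
    (hm : Measurable fun ω => ∏ i ∈ I, (if B i ω then (2⁻¹ : ENNReal) else 1)) :
    Q {ω | (I.filter fun i => B i ω).card ≤ κ} ≤ 2 ^ κ * E := by
  have h1 : {ω | (I.filter fun i => B i ω).card ≤ κ} ⊆
      {ω | (2⁻¹ : ENNReal) ^ κ ≤ ∏ i ∈ I, (if B i ω then (2⁻¹ : ENNReal) else 1)} := by
    intro ω hω
    change (2⁻¹ : ENNReal) ^ κ ≤ ∏ i ∈ I, (if B i ω then (2⁻¹ : ENNReal) else 1)
    rw [Finset.prod_ite, Finset.prod_const, Finset.prod_const_one, mul_one]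
    exact pow_le_pow_right_of_le_one' (by simp) hω
  have h2 := mul_meas_ge_le_lintegral (μ := Q) hm (2⁻¹ ^ κ)
  have h3 : (2 : ENNReal) ^ κ * 2⁻¹ ^ κ = 1 := by
    rw [← mul_pow, ENNReal.mul_inv_cancel (by simp) (by simp), one_pow]
  calc Q {ω | (I.filter fun i => B i ω).card ≤ κ}
      ≤ 2 ^ κ * (2⁻¹ ^ κ * Q {ω | (2⁻¹ : ENNReal) ^ κ ≤
          ∏ i ∈ I, (if B i ω then (2⁻¹ : ENNReal) else 1)}) := by
        rw [← mul_assoc, h3, one_mul]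
        exact measure_mono h1
    _ ≤ 2 ^ κ * E := by gcongr; exact h2.trans hE

theorem ofReal_one_sub_pow_le (u : ℝ) (N : ℕ) :
    ENNReal.ofReal (1 - u) ^ N ≤ ENNReal.ofReal (Real.exp (-(N * u))) := by
  have h1 : 1 - u ≤ Real.exp (-u) := Real.one_sub_le_exp_neg u
  calc ENNReal.ofReal (1 - u) ^ N ≤ ENNReal.ofReal (Real.exp (-u)) ^ N := by gcongr
    _ = ENNReal.ofReal (Real.exp (-(N * u))) := by
      rw [← ENNReal.ofReal_pow (Real.exp_pos _).le, ← Real.exp_nat_mul]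
      ring_nf

theorem measure_sampleCount_le {d n : ℕ} (μ : Measure (Point d)) [IsProbabilityMeasure μ]
    {R : Set (Point d)} (hR : MeasurableSet R) (κ : ℕ) :
    (Measure.pi fun _ : Fin n => μ) {S | sampleCount S R ≤ κ} ≤
      2 ^ κ * ENNReal.ofReal (Real.exp (-(n * (μ.real R / 2)))) := by
  classical
  have hg : Measurable fun x : Point d => if x ∈ R then (2⁻¹ : ENNReal) else 1 :=
    Measurable.ite hR measurable_const measurable_const
  refine measure_card_le _ Finset.univ (fun k (S : Fin n → Point d) => S k ∈ R) κ _ ?_ ?_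
  · rw [← Measure.infinitePi_eq_pi]
    rw [lintegral_prod_infinitePi (fun _ => μ) Finset.univ
      (fun _ x => if x ∈ R then (2⁻¹ : ENNReal) else 1) fun _ => hg]
    simp_rw [lintegral_half_le μ hR]
    rw [Finset.prod_const, Finset.card_univ, Fintype.card_fin]
    exact ofReal_one_sub_pow_le _ _
  · exact Finset.measurable_prod _ fun k _ => hg.comp (measurable_pi_apply k)

/-- The law of the coins. -/
noncomputable abbrev coinLaw (γ : ℝ) : Measure Bool :=
  bernoulliMeasure true false (Set.projIcc (0 : ℝ) 1 zero_le_one γ)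

theorem lintegral_coinLaw {γ : ℝ} (hγ : 0 ≤ γ) (hγ1 : γ ≤ 1) (g : Bool → ENNReal) :
    ∫⁻ b, g b ∂(coinLaw γ) =
      ENNReal.ofReal γ * g true + ENNReal.ofReal (1 - γ) * g false := by
  rw [coinLaw, Set.projIcc_of_mem _ ⟨hγ, hγ1⟩, bernoulliMeasure_def, lintegral_add_measure,
    lintegral_smul_measure, lintegral_smul_measure, lintegral_dirac, lintegral_dirac]
  rw [ENNReal.ofReal_eq_coe_nnreal hγ, ENNReal.ofReal_eq_coe_nnreal (sub_nonneg.2 hγ1)]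
  rfl

theorem measure_freshCount_le {P : Params} {d : ℕ} (μ : Measure (Point d)) [IsProbabilityMeasure μ]
    {γ : ℝ} (hγ : 0 ≤ γ) (hγ1 : γ ≤ 1) {R : Set (Point d)} (hR : MeasurableSet R) (κ p : ℕ) :
    ((Measure.infinitePi fun _ : ℕ => μ).prod (Measure.infinitePi fun _ : ℕ => coinLaw γ))
      {w | freshCount P d w.1 w.2 p (finish P d (p + 1)) R ≤ κ} ≤
      2 ^ κ * ENNReal.ofReal (Real.exp (-(P.t d (p + 1) * (γ * μ.real R / 2)))) := by
  classical
  set I := Finset.Ico (finish P d p) (finish P d (p + 1)) with hI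
  have hcard : I.card = P.t d (p + 1) := by
    rw [hI, Nat.card_Ico, finish_succ, Nat.add_sub_cancel_left]
  have hm : ∀ i : ℕ, Measurable fun w : (ℕ → Point d) × (ℕ → Bool) =>
      if w.2 i = true ∧ w.1 i ∈ R then (2⁻¹ : ENNReal) else 1 := by
    intro i
    refine Measurable.ite ?_ measurable_const measurable_const
    refine MeasurableSet.inter ?_ ?_
    · have h : Measurable fun w : (ℕ → Point d) × (ℕ → Bool) => w.2 i := by fun_prop
      exact h (MeasurableSet.singleton true)
    · have h : Measurable fun w : (ℕ → Point d) × (ℕ → Bool) => w.1 i := by fun_prop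
      exact h hR
  have hmp := Finset.measurable_prod I fun i _ => hm i
  refine measure_card_le _ I
    (fun i (w : (ℕ → Point d) × (ℕ → Bool)) => w.2 i = true ∧ w.1 i ∈ R) κ _ ?_ hmp
  rw [lintegral_prod_symm _ hmp.aemeasurable]
  have hin : ∀ coin : ℕ → Bool,
      ∫⁻ z, ∏ i ∈ I, (if coin i = true ∧ z i ∈ R then (2⁻¹ : ENNReal) else 1)
        ∂(Measure.infinitePi fun _ : ℕ => μ) =
      ∏ i ∈ I, (if coin i = true then ENNReal.ofReal (1 - μ.real R / 2) else 1) := by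
    intro coin
    rw [lintegral_prod_infinitePi (fun _ => μ) I
      (fun i x => if coin i = true ∧ x ∈ R then (2⁻¹ : ENNReal) else 1)
      (fun i => Measurable.ite ((MeasurableSet.const _).inter hR) measurable_const
        measurable_const)]
    refine Finset.prod_congr rfl fun i _ => ?_
    by_cases hc : coin i = true
    · simp only [hc, true_and, if_true]
      exact lintegral_half_le μ hR
    · simp [hc]
  simp_rw [hin]
  rw [lintegral_prod_infinitePi (fun _ => coinLaw γ) I
    (fun _ b => if b = true then ENNReal.ofReal (1 - μ.real R / 2) else 1)
    (fun _ => measurable_from_top)]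
  have h1 : μ.real R ≤ 1 := measureReal_le_one
  have hone : ∫⁻ b, (if b = true then ENNReal.ofReal (1 - μ.real R / 2) else 1) ∂(coinLaw γ) =
      ENNReal.ofReal (1 - γ * μ.real R / 2) := by
    rw [lintegral_coinLaw hγ hγ1]
    simp only [if_true, Bool.false_eq_true, if_false, mul_one]
    rw [← ENNReal.ofReal_mul hγ, ← ENNReal.ofReal_add (mul_nonneg hγ (by linarith)) (by linarith)]
    congr 1
    ring
  simp_rw [hone]
  rw [Finset.prod_const, hcard]
  exact ofReal_one_sub_pow_le _ _

/-! ### Tails of the noises -/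

theorem stdLaplace_abs_ge_le {u : ℝ} (hu : 0 ≤ u) :
    stdLaplace {x | u ≤ |x|} ≤ ENNReal.ofReal (Real.exp (-u)) := by
  have hset : {x : ℝ | u ≤ |x|} = Set.Ici u ∪ Set.Iic (-u) := by
    ext x
    simp only [Set.mem_ofPred_eq, Set.mem_union, Set.mem_Ici, Set.mem_Iic, le_abs']
    tauto
  have h1 : stdLaplace (Set.Ici u) = ENNReal.ofReal (Real.exp (-u) / 2) := by
    rw [stdLaplace, withDensity_apply _ measurableSet_Ici, setLIntegral_congr Ioi_ae_eq_Ici.symm,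
      setLIntegral_congr_fun (g := fun x => ENNReal.ofReal (Real.exp (-x) / 2)) measurableSet_Ioi
        (fun x hx => by
          have : 0 ≤ x := hu.trans (le_of_lt hx)
          simp only [abs_of_nonneg this]),
      ← ofReal_integral_eq_lintegral_ofReal ((integrableOn_exp_neg_Ioi u).div_const 2)
        (Filter.Eventually.of_forall fun x => by positivity),
      integral_div, integral_exp_neg_Ioi]
  have h2 : stdLaplace (Set.Iic (-u)) = ENNReal.ofReal (Real.exp (-u) / 2) := by
    rw [stdLaplace, withDensity_apply _ measurableSet_Iic,
      setLIntegral_congr_fun (g := fun x => ENNReal.ofReal (Real.exp x / 2)) measurableSet_Iic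
        (fun x hx => by
          have : x ≤ 0 := (show x ≤ -u from hx).trans (by linarith)
          simp only [abs_of_nonpos this, neg_neg]),
      ← ofReal_integral_eq_lintegral_ofReal ((integrableOn_exp_Iic (-u)).div_const 2)
        (Filter.Eventually.of_forall fun x => by positivity),
      integral_div, integral_exp_Iic]
  rw [hset]
  refine (measure_union_le _ _).trans (le_of_eq ?_)
  rw [h1, h2, ← ENNReal.ofReal_add (by positivity) (by positivity), add_halves]

theorem geometricMeasure_gt_le {ε : ℝ} (hε : 0 < ε) (m : ℕ) :
    geometricMeasure (Set.projIcc (0 : ℝ) 1 zero_le_one (1 - Real.exp (-ε))) {i | m < i} ≤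
      ENNReal.ofReal (Real.exp (-(ε * m))) := by
  have hlt : Real.exp (-ε) < 1 := by rw [Real.exp_lt_one_iff]; linarith
  have hpos := Real.exp_pos (-ε)
  rw [Set.projIcc_of_mem _ (show 1 - Real.exp (-ε) ∈ Set.Icc (0 : ℝ) 1 from
    ⟨by linarith, by linarith⟩)]
  set p : unitInterval := ⟨1 - Real.exp (-ε), by linarith, by linarith⟩ with hp
  have hp0 : p ≠ 0 := by
    intro h
    have := congrArg Subtype.val h
    simp only [hp, Set.Icc.coe_zero] at this
    linarith
  have h1 : (geometricMeasure p).real {i | m < i}ᶜ = 1 - Real.exp (-ε) ^ (m + 1) := by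
    have hset : {i | m < i}ᶜ = ((Finset.range (m + 1) : Finset ℕ) : Set ℕ) := by
      ext i; simp
    rw [hset, ← sum_measureReal_singleton]
    simp_rw [geometricMeasure_real_singleton hp0]
    rw [← Finset.sum_mul]
    have := geom_sum_mul_neg (Real.exp (-ε)) (m + 1)
    simpa [hp] using this
  rw [probReal_compl_eq_one_sub (MeasurableSet.of_discrete)] at h1
  rw [← ofReal_measureReal]
  refine ENNReal.ofReal_le_ofReal ?_
  have h2 : Real.exp (-(ε * m)) = Real.exp (-ε) ^ m := by
    rw [← Real.exp_nat_mul]; ring_nf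
  have h3 : Real.exp (-ε) ^ (m + 1) ≤ Real.exp (-ε) ^ m :=
    pow_le_pow_of_le_one hpos.le hlt.le (Nat.le_succ m)
  linarith

/-! ### Estimates for the parameters -/

/-- The ranges of the parameters, and the requirements on the hidden constants. -/
structure Admissible (P : Params) (d : ℕ) : Prop where
  d_pos : 1 ≤ d
  α_pos : 0 < P.α
  α_lt : P.α < 1
  β_pos : 0 < P.β
  β_lt : P.β < 1
  γ_pos : 0 < P.γ
  γ_le : P.γ ≤ 1
  ε_pos : 0 < P.ε
  ε_le : P.ε ≤ 1
  δstar_pos : 0 < P.δstar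
  δstar_lt : P.δstar < 1
  cδ_pos : 0 < P.cδ
  cδ_le : P.cδ ≤ 1
  ct_ge : 2120 ≤ P.ct
  cΔ_ge : 40 ≤ P.cΔ
  cm_ge : 18 * P.cΔ ^ 2 * (Real.log (64 * P.ct * P.cm) + 7) ^ 2 ≤ P.cm
  one_le_cm : 1 ≤ P.cm

/-- The logarithm `log (d / (α_p β_p γ ε δ_p))` in the definition of `m_p`. All logarithmic terms of
phase `p` are bounded by multiples of it. -/
noncomputable def ell (P : Params) (d p : ℕ) : ℝ :=
  Real.log (d / (P.alpha p * P.beta p * P.γ * P.ε * P.delta d p))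

/-- The factor by which `log (16 d t_p / β_p)` and `log (d t_p / δ_p)` may exceed `ell`. -/
noncomputable def logFactor (P : Params) : ℝ := Real.log (64 * P.ct * P.cm) + 7

theorem le_m (P : Params) (d p : ℕ) : P.cm / P.ε ^ 2 * ell P d p ^ 5 ≤ P.m d p := Nat.le_ceil _

theorem le_t (P : Params) (d p : ℕ) : P.ct * d * P.m d p / (P.γ * P.alpha p) ≤ P.t d p :=
  Nat.le_ceil _

section Estimates

variable {P : Params} {d : ℕ} (h : Admissible P d) {p : ℕ} (hp : 1 ≤ p)
include h

theorem d_pos_real : (1 : ℝ) ≤ d := by exact_mod_cast h.d_pos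

theorem deltaMain_pos (p : ℕ) : 0 < P.deltaMain d p := by
  have := d_pos_real h
  have := h.α_pos
  have := h.β_pos
  have := h.γ_pos
  have := h.ε_pos
  have := h.δstar_pos
  rw [Params.deltaMain]
  positivity

theorem alpha_pos (p : ℕ) : 0 < P.alpha p := by
  have := h.α_pos
  rw [Params.alpha]; positivity

theorem beta_pos (p : ℕ) : 0 < P.beta p := by
  have := h.β_pos
  rw [Params.beta]; positivity

omit h in
theorem two_le_two_pow (hp : 1 ≤ p) : (2 : ℝ) ≤ 2 ^ p := by
  calc (2 : ℝ) = 2 ^ 1 := by norm_num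
    _ ≤ 2 ^ p := pow_le_pow_right₀ (by norm_num) hp

include hp

theorem alpha_le : P.alpha p ≤ 1 / 2 := by
  have := two_le_two_pow hp
  rw [Params.alpha, div_le_iff₀ (by positivity)]
  linarith [h.α_lt]

theorem beta_le : P.beta p ≤ 1 / 2 := by
  have := two_le_two_pow hp
  rw [Params.beta, div_le_iff₀ (by positivity)]
  linarith [h.β_lt]

theorem deltaMain_le : P.deltaMain d p ≤ 1 / 8 := by
  have hd := d_pos_real h
  have h8 : (8 : ℝ) ≤ 8 ^ p := by
    calc (8 : ℝ) = 8 ^ 1 := by norm_num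
      _ ≤ 8 ^ p := pow_le_pow_right₀ (by norm_num) hp
  have hnum : P.δstar * P.γ * P.α * P.ε ^ 2 * P.β ≤ 1 := by
    have h1 := h.α_pos
    have h2 := h.β_pos
    have h3 := h.γ_pos
    have h4 := h.ε_pos
    have h5 := h.δstar_pos
    refine mul_le_one₀ (mul_le_one₀ (mul_le_one₀ (mul_le_one₀ h.δstar_lt.le h3.le h.γ_le) h1.le
      h.α_lt.le) (by positivity) (pow_le_one₀ h4.le h.ε_le)) h2.le h.β_lt.le
  rw [Params.deltaMain]
  exact div_le_div₀ (by norm_num) hnum (by norm_num) (by nlinarith)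

theorem two_le_log_deltaMain : 2 ≤ Real.log (1 / P.deltaMain d p) := by
  have h0 := deltaMain_pos h p
  have h1 : (8 : ℝ) ≤ 1 / P.deltaMain d p := by
    rw [le_div_iff₀ h0]
    linarith [deltaMain_le h hp]
  have h2 : Real.log 8 = 3 * Real.log 2 := by
    rw [show (8 : ℝ) = 2 ^ 3 by norm_num, Real.log_pow]; norm_num
  have h3 := Real.log_le_log (by norm_num) h1
  have := Real.log_two_gt_d9
  linarith

theorem delta_pos : 0 < P.delta d p := by
  have h0 := deltaMain_pos h p
  have h1 := two_le_log_deltaMain h hp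
  have h2 := h.cδ_pos
  rw [Params.delta]
  positivity

theorem delta_le : P.delta d p ≤ 1 / 8 := by
  have h0 := deltaMain_pos h p
  have h1 := two_le_log_deltaMain h hp
  have h2 := h.cδ_pos
  have h3 := deltaMain_le h hp
  have h4 : 1 ≤ Real.log (1 / P.deltaMain d p) ^ P.aδ := one_le_pow₀ (by linarith)
  rw [Params.delta]
  refine (div_le_self (by positivity) h4).trans ?_
  exact (mul_le_of_le_one_left h0.le h.cδ_le).trans h3

/-- Passing from one phase to the next at most squares `δ_p`, whatever the exponent `aδ` is. -/
theorem delta_sq_le : P.delta d p ^ 2 ≤ P.delta d (p + 1) := by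
  have h0 := deltaMain_pos h p
  have h1 := two_le_log_deltaMain h hp
  have h2 := h.cδ_pos
  have h3 := deltaMain_le h hp
  have hQ : P.deltaMain d (p + 1) = P.deltaMain d p / 8 := by
    rw [Params.deltaMain, Params.deltaMain, pow_succ (8 : ℝ), div_div, mul_assoc (d : ℝ)]
  set Q := P.deltaMain d p with hQ0
  set u := Real.log (1 / Q) with hu
  have hlog : Real.log (1 / P.deltaMain d (p + 1)) ≤ u ^ 2 := by
    have h4 : Real.log (1 / P.deltaMain d (p + 1)) = Real.log 8 + u := by
      rw [hQ, hu, ← Real.log_mul (by norm_num) (by positivity)]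
      congr 1
      field_simp
    have h5 : Real.log 8 ≤ u := by
      refine Real.log_le_log (by norm_num) ?_
      rw [le_div_iff₀ h0]
      linarith
    nlinarith
  have hlog0 : 0 < Real.log (1 / P.deltaMain d (p + 1)) := by
    linarith [two_le_log_deltaMain h (show 1 ≤ p + 1 by omega)]
  have h6 : Real.log (1 / P.deltaMain d (p + 1)) ^ P.aδ ≤ (u ^ P.aδ) ^ 2 := by
    rw [← pow_mul, mul_comm, pow_mul]
    exact pow_le_pow_left₀ hlog0.le hlog _
  rw [Params.delta, Params.delta, div_pow, ← hQ0, ← hu]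
  refine div_le_div₀ (mul_nonneg h2.le (deltaMain_pos h _).le) ?_ (by positivity) h6
  rw [hQ, mul_pow]
  have h7 : P.cδ ^ 2 ≤ P.cδ := by nlinarith [h.cδ_le]
  have h8 : Q ^ 2 ≤ Q / 8 := by nlinarith
  exact mul_le_mul h7 h8 (by positivity) h2.le

theorem ell_eq : ell P d p = Real.log d - Real.log (P.alpha p) - Real.log (P.beta p) -
    Real.log P.γ - Real.log P.ε - Real.log (P.delta d p) := by
  have h1 := d_pos_real h
  have h2 := alpha_pos h p
  have h3 := beta_pos h p
  have h4 := h.γ_pos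
  have h5 := h.ε_pos
  have h6 := delta_pos h hp
  rw [ell, Real.log_div (by positivity) (by positivity), Real.log_mul (by positivity) h6.ne',
    Real.log_mul (by positivity) h5.ne', Real.log_mul (by positivity) h4.ne',
    Real.log_mul h2.ne' h3.ne']
  ring

/-- The signs and sizes of the summands of `ell`. -/
theorem log_bounds : 0 ≤ Real.log d ∧ Real.log (P.alpha p) ≤ -Real.log 2 ∧
    Real.log (P.beta p) ≤ -Real.log 2 ∧ Real.log P.γ ≤ 0 ∧ Real.log P.ε ≤ 0 ∧
    Real.log (P.delta d p) ≤ -3 * Real.log 2 := by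
  refine ⟨Real.log_nonneg (d_pos_real h), ?_, ?_, Real.log_nonpos h.γ_pos.le h.γ_le,
    Real.log_nonpos h.ε_pos.le h.ε_le, ?_⟩
  · have := Real.log_le_log (alpha_pos h p) (alpha_le h hp)
    rwa [one_div, Real.log_inv] at this
  · have := Real.log_le_log (beta_pos h p) (beta_le h hp)
    rwa [one_div, Real.log_inv] at this
  · have := Real.log_le_log (delta_pos h hp) (delta_le h hp)
    rw [one_div, Real.log_inv, show (8 : ℝ) = 2 ^ 3 by norm_num, Real.log_pow] at this
    push_cast at this
    linarith

theorem two_le_ell : 2 ≤ ell P d p := by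
  obtain ⟨h1, h2, h3, h4, h5, h6⟩ := log_bounds h hp
  rw [ell_eq h hp]
  have := Real.log_two_gt_d9
  linarith

theorem ell_succ_le : ell P d (p + 1) ≤ 2 * ell P d p := by
  obtain ⟨h1, h2, h3, h4, h5, h6⟩ := log_bounds h hp
  have hα : Real.log (P.alpha (p + 1)) = Real.log (P.alpha p) - Real.log 2 := by
    rw [← Real.log_div (alpha_pos h p).ne' (by norm_num)]
    congr 1
    rw [Params.alpha, Params.alpha, pow_succ, div_div]
  have hβ : Real.log (P.beta (p + 1)) = Real.log (P.beta p) - Real.log 2 := by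
    rw [← Real.log_div (beta_pos h p).ne' (by norm_num)]
    congr 1
    rw [Params.beta, Params.beta, pow_succ, div_div]
  have hδ := Real.log_le_log (pow_pos (delta_pos h hp) 2) (delta_sq_le h hp)
  rw [Real.log_pow] at hδ
  push_cast at hδ
  rw [ell_eq h hp, ell_eq h (by omega), hα, hβ]
  linarith

theorem one_le_m_arg : 1 ≤ P.cm / P.ε ^ 2 * ell P d p ^ 5 := by
  have h1 := two_le_ell h hp
  have h2 := h.one_le_cm
  have h3 := h.ε_pos
  have h4 : 1 ≤ P.cm / P.ε ^ 2 := by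
    rw [le_div_iff₀ (by positivity)]
    nlinarith [h.ε_le]
  exact one_le_mul_of_one_le_of_one_le h4 (one_le_pow₀ (by linarith))

theorem m_le : (P.m d p : ℝ) ≤ 2 * (P.cm / P.ε ^ 2 * ell P d p ^ 5) := by
  have h1 := one_le_m_arg h hp
  have h2 : (P.m d p : ℝ) < P.cm / P.ε ^ 2 * ell P d p ^ 5 + 1 :=
    Nat.ceil_lt_add_one (zero_le_one.trans h1)
  linarith

theorem one_le_m : (1 : ℝ) ≤ P.m d p := (one_le_m_arg h hp).trans (le_m P d p)

theorem ell_le_m : ell P d p ≤ P.m d p := by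
  refine le_trans ?_ (le_m P d p)
  have h1 := two_le_ell h hp
  have h2 := h.one_le_cm
  have h3 := h.ε_pos
  have h4 : 1 ≤ P.cm / P.ε ^ 2 := by
    rw [le_div_iff₀ (by positivity)]
    nlinarith [h.ε_le]
  have h5 : ell P d p ≤ ell P d p ^ 5 := le_self_pow₀ (by linarith) (by norm_num)
  have h6 : 0 ≤ ell P d p ^ 5 := by positivity
  nlinarith

theorem m_succ_le : (P.m d (p + 1) : ℝ) ≤ 64 * P.m d p := by
  have h1 := m_le h (show 1 ≤ p + 1 by omega)
  have h2 := le_m P d p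
  have h3 := ell_succ_le h hp
  have h4 := two_le_ell h (show 1 ≤ p + 1 by omega)
  have h5 := h.one_le_cm
  have h6 := h.ε_pos
  have h7 : ell P d (p + 1) ^ 5 ≤ 32 * ell P d p ^ 5 := by
    calc ell P d (p + 1) ^ 5 ≤ (2 * ell P d p) ^ 5 := pow_le_pow_left₀ (by linarith) h3 5
      _ = 32 * ell P d p ^ 5 := by ring
  have h8 : P.cm / P.ε ^ 2 * ell P d (p + 1) ^ 5 ≤ P.cm / P.ε ^ 2 * (32 * ell P d p ^ 5) :=
    mul_le_mul_of_nonneg_left h7 (by positivity)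
  linarith

theorem one_le_t_arg : 1 ≤ P.ct * d * P.m d p / (P.γ * P.alpha p) := by
  have h1 := d_pos_real h
  have h2 := one_le_m h hp
  have h3 := h.ct_ge
  have h4 := alpha_pos h p
  have h5 := h.γ_pos
  rw [le_div_iff₀ (by positivity), one_mul]
  have h6 : P.γ * P.alpha p ≤ 1 := mul_le_one₀ h.γ_le h4.le (by linarith [alpha_le h hp])
  exact h6.trans (one_le_mul_of_one_le_of_one_le
    (one_le_mul_of_one_le_of_one_le (by linarith) h1) h2)

theorem t_le : (P.t d p : ℝ) ≤ 2 * (P.ct * d * P.m d p / (P.γ * P.alpha p)) := by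
  have h1 := one_le_t_arg h hp
  have h2 : (P.t d p : ℝ) < P.ct * d * P.m d p / (P.γ * P.alpha p) + 1 :=
    Nat.ceil_lt_add_one (zero_le_one.trans h1)
  linarith

theorem one_le_t : (1 : ℝ) ≤ P.t d p := (one_le_t_arg h hp).trans (le_t P d p)

theorem log_t_le : Real.log (P.t d p) ≤ 2 * Real.log 2 + Real.log P.ct + Real.log P.cm +
    5 * ell P d p + Real.log d - 2 * Real.log P.ε - Real.log P.γ - Real.log (P.alpha p) := by
  have h1 := d_pos_real h
  have h2 := one_le_m h hp
  have h3 := h.ct_ge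
  have h4 := alpha_pos h p
  have h5 := h.γ_pos
  have h6 := h.ε_pos
  have h7 := h.one_le_cm
  have h8 := two_le_ell h hp
  have h9 := Real.log_le_log (by linarith [one_le_t h hp]) (t_le h hp)
  have h10 := Real.log_le_log (by linarith) (m_le h hp)
  rw [Real.log_mul (by norm_num) (by positivity), Real.log_div (by positivity) (by positivity),
    Real.log_mul (by positivity) (by positivity), Real.log_mul (by positivity) (by positivity),
    Real.log_mul (by positivity) (by positivity)] at h9
  rw [Real.log_mul (by norm_num) (by positivity), Real.log_mul (by positivity) (by positivity),
    Real.log_div (by positivity) (by positivity), Real.log_pow, Real.log_pow] at h10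
  push_cast at h10
  have h11 := Real.log_le_self (show 0 ≤ ell P d p by linarith)
  linarith

omit hp in
theorem logFactor_eq : logFactor P = 6 * Real.log 2 + Real.log P.ct + Real.log P.cm + 7 := by
  have h3 := h.ct_ge
  have h7 := h.one_le_cm
  rw [logFactor, Real.log_mul (by positivity) (by positivity),
    Real.log_mul (by positivity) (by positivity), show (64 : ℝ) = 2 ^ 6 by norm_num, Real.log_pow]
  norm_num

omit hp in
theorem seven_le_logFactor : 7 ≤ logFactor P := by
  have h3 := h.ct_ge
  have h7 := h.one_le_cm
  rw [logFactor_eq h]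
  have := Real.log_nonneg (show 1 ≤ P.ct by linarith)
  have := Real.log_nonneg h7
  have := Real.log_two_gt_d9
  linarith

theorem log_dt_div_beta : Real.log (d * P.t d p / P.beta p) =
    Real.log d + Real.log (P.t d p) - Real.log (P.beta p) := by
  have h1 := d_pos_real h
  have h2 := one_le_t h hp
  have h3 := beta_pos h p
  rw [Real.log_div (by positivity) h3.ne', Real.log_mul (by positivity) (by positivity)]

theorem log_sixteen_dt_div_beta : Real.log (16 * d * P.t d p / P.beta p) =
    4 * Real.log 2 + Real.log d + Real.log (P.t d p) - Real.log (P.beta p) := by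
  have h1 := d_pos_real h
  have h2 := one_le_t h hp
  have h3 := beta_pos h p
  rw [Real.log_div (by positivity) h3.ne', Real.log_mul (by positivity) (by positivity),
    Real.log_mul (by positivity) (by positivity), show (16 : ℝ) = 2 ^ 4 by norm_num, Real.log_pow]
  norm_num

theorem log_sixteen_dt_div_beta_le :
    Real.log (16 * d * P.t d p / P.beta p) ≤ logFactor P * ell P d p := by
  obtain ⟨h1, h2, h3, h4, h5, h6⟩ := log_bounds h hp
  have h7 := log_t_le h hp
  have h8 := two_le_ell h hp
  have h9 := seven_le_logFactor h
  rw [log_sixteen_dt_div_beta h hp]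
  have h10 : logFactor P - 7 + 7 * ell P d p ≤ logFactor P * ell P d p := by nlinarith
  have h11 := logFactor_eq h
  have h12 := ell_eq h hp
  have := Real.log_two_gt_d9
  linarith

theorem log_t_div_copyDelta_le :
    Real.log (P.t d p / P.copyDelta d p) ≤ logFactor P * ell P d p := by
  obtain ⟨h1, h2, h3, h4, h5, h6⟩ := log_bounds h hp
  have h7 := log_t_le h hp
  have h8 := two_le_ell h hp
  have h9 := seven_le_logFactor h
  have hd := d_pos_real h
  have ht := one_le_t h hp
  have hδ := delta_pos h hp
  rw [Params.copyDelta, Real.log_div (by positivity) (by positivity),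
    Real.log_div (by positivity) (by positivity)]
  have h10 : logFactor P - 7 + 7 * ell P d p ≤ logFactor P * ell P d p := by nlinarith
  have h11 := logFactor_eq h
  have h12 := ell_eq h hp
  have := Real.log_two_gt_d9
  linarith

theorem log_inv_delta_bounds : 2 ≤ Real.log (1 / P.delta d p) ∧
    Real.log (1 / P.delta d p) ≤ ell P d p := by
  obtain ⟨h1, h2, h3, h4, h5, h6⟩ := log_bounds h hp
  have := Real.log_two_gt_d9
  rw [one_div, Real.log_inv, ell_eq h hp]
  constructor <;> linarith

theorem log_d_div_delta : Real.log (d / P.delta d p) = Real.log d - Real.log (P.delta d p) :=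
  Real.log_div (by linarith [d_pos_real h]) (delta_pos h hp).ne'

theorem copyEps_pos : 0 < P.copyEps d p :=
  div_pos h.ε_pos (by linarith [(log_inv_delta_bounds h hp).1])

theorem stopNoise_eq : P.stopNoise d p =
    8 * Real.log (1 / P.delta d p) / P.ε * (Real.log 2 + Real.log (d / P.delta d p)) := by
  have hd := d_pos_real h
  have hδ := delta_pos h hp
  have h1 := (log_inv_delta_bounds h hp).1
  rw [Params.stopNoise, stopperScale, Params.copyEps, Params.copyDelta,
    ← Real.log_mul (by norm_num) (by positivity), div_div_eq_mul_div, div_div_eq_mul_div,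
    mul_div_assoc 2]

theorem stopNoise_pos : 0 < P.stopNoise d p := by
  obtain ⟨h1, h2, h3, h4, h5, h6⟩ := log_bounds h hp
  have h7 := (log_inv_delta_bounds h hp).1
  have h8 := h.ε_pos
  have := Real.log_two_gt_d9
  rw [stopNoise_eq h hp, log_d_div_delta h hp]
  exact mul_pos (by positivity) (by linarith)

theorem stopNoise_mul_le_m : P.stopNoise d p * (logFactor P * ell P d p) ≤ P.m d p := by
  obtain ⟨h1, h2, h3, h4, h5, h6⟩ := log_bounds h hp
  obtain ⟨h7, h8⟩ := log_inv_delta_bounds h hp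
  have hε := h.ε_pos
  have hl2 := Real.log_two_gt_d9
  have hell := two_le_ell h hp
  have hB := seven_le_logFactor h
  have hcm : 18 * P.cΔ ^ 2 * logFactor P ^ 2 ≤ P.cm := h.cm_ge
  have hcΔ := h.cΔ_ge
  have h9 : P.stopNoise d p ≤ 16 * ell P d p ^ 2 / P.ε := by
    rw [stopNoise_eq h hp, log_d_div_delta h hp]
    have h10 : Real.log 2 + (Real.log d - Real.log (P.delta d p)) ≤ 2 * ell P d p := by
      rw [ell_eq h hp]; linarith
    calc 8 * Real.log (1 / P.delta d p) / P.ε *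
          (Real.log 2 + (Real.log d - Real.log (P.delta d p)))
        ≤ 8 * ell P d p / P.ε * (2 * ell P d p) := by
          refine mul_le_mul ?_ h10 (by linarith) (by positivity)
          gcongr
      _ = 16 * ell P d p ^ 2 / P.ε := by ring
  refine le_trans ?_ (le_m P d p)
  have h11 : 16 * logFactor P ≤ P.cm := by
    have h13 : 1600 ≤ P.cΔ ^ 2 := by nlinarith
    have : 16 * logFactor P ≤ 18 * 1600 * logFactor P ^ 2 := by nlinarith
    have : 18 * 1600 * logFactor P ^ 2 ≤ 18 * P.cΔ ^ 2 * logFactor P ^ 2 := by gcongr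
    linarith
  calc P.stopNoise d p * (logFactor P * ell P d p)
      ≤ 16 * ell P d p ^ 2 / P.ε * (logFactor P * ell P d p) := by gcongr
    _ = 16 * logFactor P * ell P d p ^ 3 / P.ε := by ring
    _ ≤ P.cm * ell P d p ^ 5 / P.ε ^ 2 := by
        refine div_le_div₀ (by have := h.one_le_cm; positivity) ?_ (by positivity)
          (by nlinarith [h.ε_le])
        refine mul_le_mul h11 (pow_le_pow_right₀ (by linarith) (by norm_num)) (by positivity)
          (by linarith [h.one_le_cm])
    _ = P.cm / P.ε ^ 2 * ell P d p ^ 5 := by ring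

/-- The noise of a stopping query is below `m_p`, except with probability `β_p / (16 d t_p)`. -/
theorem log_le_m_div_stopNoise :
    Real.log (16 * d * P.t d p / P.beta p) ≤ P.m d p / P.stopNoise d p := by
  rw [le_div_iff₀ (stopNoise_pos h hp), mul_comm]
  refine le_trans ?_ (stopNoise_mul_le_m h hp)
  exact mul_le_mul_of_nonneg_left (log_sixteen_dt_div_beta_le h hp) (stopNoise_pos h hp).le

theorem two_le_log_d_div_delta : 2 ≤ Real.log (d / P.delta d p) := by
  obtain ⟨h1, h2, h3, h4, h5, h6⟩ := log_bounds h hp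
  have := Real.log_two_gt_d9
  rw [log_d_div_delta h hp]
  linarith

theorem challengeK_bounds :
    0 < challengeK (P.copyEps d p) (P.copyDelta d p) (P.k d p) (P.t d p) ∧
    challengeK (P.copyEps d p) (P.copyDelta d p) (P.k d p) (P.t d p) ≤ 3 / 2 * P.k d p := by
  have h1 : challengeK (P.copyEps d p) (P.copyDelta d p) (P.k d p) (P.t d p) =
      P.k d p + P.stopNoise d p * Real.log (P.t d p / P.copyDelta d p) := rfl
  have hk : (P.k d p : ℝ) = 2 * P.m d p := by rw [Params.k]; push_cast; ring
  have h2 := (mul_le_mul_of_nonneg_left (log_t_div_copyDelta_le h hp)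
    (stopNoise_pos h hp).le).trans (stopNoise_mul_le_m h hp)
  have h3 : 0 ≤ Real.log (P.t d p / P.copyDelta d p) := by
    refine Real.log_nonneg ?_
    have hd := d_pos_real h
    have hδ := delta_pos h hp
    have hδ1 := delta_le h hp
    have h4 : P.copyDelta d p ≤ 1 := by
      rw [Params.copyDelta, div_le_one (by linarith)]
      linarith
    have h5 : 0 < P.copyDelta d p := by rw [Params.copyDelta]; positivity
    rw [le_div_iff₀ h5]
    linarith [one_le_t h hp]
  have h4 := mul_nonneg (stopNoise_pos h hp).le h3
  have h5 := one_le_m h hp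
  rw [h1, hk]
  constructor <;> linarith

theorem btNoise_eq : P.btNoise d p = 4 * Real.log (1 / P.delta d p) / P.ε *
    √(challengeK (P.copyEps d p) (P.copyDelta d p) (P.k d p) (P.t d p) *
      (2 * Real.log 2 + Real.log (d / P.delta d p))) := by
  have hd := d_pos_real h
  have hδ := delta_pos h hp
  have h1 : Real.log (2 / (P.copyDelta d p / 2)) =
      2 * Real.log 2 + Real.log (d / P.delta d p) := by
    rw [Params.copyDelta, ← Real.log_rpow (by norm_num),
      ← Real.log_mul (by norm_num) (by positivity)]
    congr 1
    norm_num
    field_simp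
    norm_num
  rw [Params.btNoise, btScale, h1]
  congr 1
  rw [Params.copyEps, div_div_eq_mul_div]

theorem btNoise_pos : 0 < P.btNoise d p := by
  have h1 := (log_inv_delta_bounds h hp).1
  have h2 := (challengeK_bounds h hp).1
  have h3 := two_le_log_d_div_delta h hp
  have h4 := h.ε_pos
  have := Real.log_two_gt_d9
  rw [btNoise_eq h hp]
  exact mul_pos (by positivity) (Real.sqrt_pos.2 (mul_pos h2 (by linarith)))

theorem log_two_le_log_dt_div_beta : Real.log 2 ≤ Real.log (d * P.t d p / P.beta p) := by
  obtain ⟨h1, h2, h3, h4, h5, h6⟩ := log_bounds h hp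
  rw [log_dt_div_beta h hp]
  have := Real.log_nonneg (one_le_t h hp)
  linarith

/-- The noise of a `BetweenThresholds` query is below `Δ_p`, except with probability
`β_p / (16 d t_p)`. -/
theorem log_le_threshold_div_btNoise :
    Real.log (16 * d * P.t d p / P.beta p) ≤ P.threshold d p / P.btNoise d p := by
  have h1 := (log_inv_delta_bounds h hp).1
  have h2 := challengeK_bounds h hp
  have h3 := two_le_log_d_div_delta h hp
  have hε := h.ε_pos
  have hl2 := Real.log_two_gt_d9
  have hl2' := Real.log_two_lt_d9
  have h5 := log_two_le_log_dt_div_beta h hp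
  have hcΔ := h.cΔ_ge
  rw [le_div_iff₀ (btNoise_pos h hp)]
  have h4 : √(challengeK (P.copyEps d p) (P.copyDelta d p) (P.k d p) (P.t d p) *
      (2 * Real.log 2 + Real.log (d / P.delta d p))) ≤
      2 * √(P.k d p * Real.log (d / P.delta d p)) := by
    rw [show (2 : ℝ) * √(P.k d p * Real.log (d / P.delta d p)) =
      √(4 * (P.k d p * Real.log (d / P.delta d p))) by
        rw [Real.sqrt_mul (by norm_num) (P.k d p * Real.log (d / P.delta d p)),
          show (4 : ℝ) = 2 ^ 2 by norm_num, Real.sqrt_sq (by norm_num)]]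
    refine Real.sqrt_le_sqrt ?_
    calc challengeK (P.copyEps d p) (P.copyDelta d p) (P.k d p) (P.t d p) *
          (2 * Real.log 2 + Real.log (d / P.delta d p))
        ≤ (3 / 2 * P.k d p) * (2 * Real.log (d / P.delta d p)) :=
          mul_le_mul h2.2 (by linarith) (by linarith) (by positivity)
      _ ≤ 4 * (P.k d p * Real.log (d / P.delta d p)) := by
        have : 0 ≤ P.k d p * Real.log (d / P.delta d p) := by positivity
        linarith
  have h6 : Real.log (16 * d * P.t d p / P.beta p) ≤ 5 * Real.log (d * P.t d p / P.beta p) := by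
    have := log_sixteen_dt_div_beta h hp
    have := log_dt_div_beta h hp
    linarith
  rw [btNoise_eq h hp, Params.threshold]
  set l := Real.log (1 / P.delta d p)
  set s := √(P.k d p * Real.log (d / P.delta d p))
  set w := Real.log (d * P.t d p / P.beta p)
  have hw : 0 ≤ w := by linarith
  have hs : 0 ≤ s := Real.sqrt_nonneg _
  calc Real.log (16 * d * P.t d p / P.beta p) * (4 * l / P.ε *
      √(challengeK (P.copyEps d p) (P.copyDelta d p) (P.k d p) (P.t d p) *
      (2 * Real.log 2 + Real.log (d / P.delta d p))))
      ≤ (5 * w) * (4 * l / P.ε * (2 * s)) := by gcongr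
    _ = 40 * (l / P.ε) * s * w := by ring
    _ ≤ P.cΔ * (l / P.ε) * s * w := by gcongr

theorem threshold_le_m : 3 * P.threshold d p ≤ P.m d p := by
  obtain ⟨h1, h2⟩ := log_inv_delta_bounds h hp
  have h3 := two_le_log_d_div_delta h hp
  have hε := h.ε_pos
  have hcΔ := h.cΔ_ge
  have hell := two_le_ell h hp
  have hB := seven_le_logFactor h
  have hcm : 18 * P.cΔ ^ 2 * logFactor P ^ 2 ≤ P.cm := h.cm_ge
  have hl2 := Real.log_two_gt_d9
  have h5 := log_two_le_log_dt_div_beta h hp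
  have hm := le_m P d p
  have hm1 := one_le_m h hp
  have h3' : Real.log (d / P.delta d p) ≤ ell P d p := by
    obtain ⟨h1, h2, h3, h4, h5, h6⟩ := log_bounds h hp
    rw [log_d_div_delta h hp, ell_eq h hp]
    linarith
  have h6 : Real.log (d * P.t d p / P.beta p) ≤ logFactor P * ell P d p := by
    have := log_sixteen_dt_div_beta h hp
    have := log_dt_div_beta h hp
    have := log_sixteen_dt_div_beta_le h hp
    linarith
  have hk : (P.k d p : ℝ) = 2 * P.m d p := by rw [Params.k]; push_cast; ring
  have hl0 : 0 ≤ Real.log (1 / P.delta d p) / P.ε := by positivity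
  have hw0 : 0 ≤ Real.log (d * P.t d p / P.beta p) := by linarith
  have h7 : Real.log (1 / P.delta d p) / P.ε ≤ ell P d p / P.ε := by gcongr
  -- After squaring, the claim is `18 cΔ² B² ℓ⁵ / ε² ≤ m_p` for `B = logFactor P`.
  have hsq : P.threshold d p ^ 2 ≤
      2 * P.cΔ ^ 2 * logFactor P ^ 2 / P.ε ^ 2 * ell P d p ^ 5 * P.m d p := by
    rw [Params.threshold, mul_pow, mul_pow, mul_pow, Real.sq_sqrt (by positivity), hk]
    calc P.cΔ ^ 2 * (Real.log (1 / P.delta d p) / P.ε) ^ 2 *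
          (2 * P.m d p * Real.log (d / P.delta d p)) * Real.log (d * P.t d p / P.beta p) ^ 2
        ≤ P.cΔ ^ 2 * (ell P d p / P.ε) ^ 2 * (2 * P.m d p * ell P d p) *
          (logFactor P * ell P d p) ^ 2 := by gcongr
      _ = _ := by ring
  have hcm' : 9 * (2 * P.cΔ ^ 2 * logFactor P ^ 2 / P.ε ^ 2 * ell P d p ^ 5) ≤ P.m d p := by
    refine le_trans ?_ hm
    calc 9 * (2 * P.cΔ ^ 2 * logFactor P ^ 2 / P.ε ^ 2 * ell P d p ^ 5)
        = 18 * P.cΔ ^ 2 * logFactor P ^ 2 / P.ε ^ 2 * ell P d p ^ 5 := by ring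
      _ ≤ P.cm / P.ε ^ 2 * ell P d p ^ 5 := by gcongr
  refine le_of_abs_le (abs_le_of_sq_le_sq ?_ (by linarith))
  calc (3 * P.threshold d p) ^ 2 = 9 * P.threshold d p ^ 2 := by ring
    _ ≤ 9 * (2 * P.cΔ ^ 2 * logFactor P ^ 2 / P.ε ^ 2 * ell P d p ^ 5 * P.m d p) := by gcongr
    _ = 9 * (2 * P.cΔ ^ 2 * logFactor P ^ 2 / P.ε ^ 2 * ell P d p ^ 5) * P.m d p := by ring
    _ ≤ P.m d p * P.m d p := by gcongr
    _ = (P.m d p : ℝ) ^ 2 := by ring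

theorem fit_aux : 0 < P.t d p ∧ 0 < P.m d p := by
  have h1 := one_le_t h hp
  have h2 := one_le_m h hp
  constructor
  · exact_mod_cast (by linarith : (0 : ℝ) < P.t d p)
  · exact_mod_cast (by linarith : (0 : ℝ) < P.m d p)

omit hp in
theorem fit : Fit P d :=
  ⟨fun _ hp => (fit_aux h hp).1, fun _ hp => (fit_aux h hp).2, fun _ hp => threshold_le_m h hp⟩

theorem geom_tail_le :
    2 * d * Real.exp (-(P.copyEps d p * P.m d p)) ≤ P.beta p / 4 := by
  obtain ⟨h1, h2⟩ := log_inv_delta_bounds h hp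
  have hε := h.ε_pos
  have hell := two_le_ell h hp
  have hd := d_pos_real h
  have hβ := beta_pos h p
  have h3 : ell P d p ≤ P.copyEps d p * P.m d p := by
    have h4 : ell P d p ^ 2 / P.ε ≤ P.m d p := by
      refine le_trans ?_ (le_m P d p)
      rw [div_mul_eq_mul_div]
      refine div_le_div₀ (by have := h.one_le_cm; positivity) ?_ (by positivity)
        (by nlinarith [h.ε_le])
      have h5 : ell P d p ^ 2 ≤ ell P d p ^ 5 := pow_le_pow_right₀ (by linarith) (by norm_num)
      have h6 : 0 ≤ ell P d p ^ 5 := by positivity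
      nlinarith [h.one_le_cm]
    rw [Params.copyEps, div_mul_eq_mul_div, le_div_iff₀ (by linarith)]
    rw [div_le_iff₀ hε] at h4
    nlinarith
  have h4 : Real.log (8 * d / P.beta p) ≤ ell P d p := by
    obtain ⟨h1, h2, h3, h4, h5, h6⟩ := log_bounds h hp
    rw [Real.log_div (by positivity) hβ.ne', Real.log_mul (by norm_num) (by positivity),
      show (8 : ℝ) = 2 ^ 3 by norm_num, Real.log_pow, ell_eq h hp]
    push_cast
    linarith [Real.log_two_gt_d9]
  have h5 : Real.exp (-(P.copyEps d p * P.m d p)) ≤ (8 * d / P.beta p)⁻¹ := by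
    rw [← Real.exp_log (show 0 < 8 * d / P.beta p by positivity), ← Real.exp_neg]
    exact Real.exp_le_exp.2 (by linarith)
  calc 2 * d * Real.exp (-(P.copyEps d p * P.m d p)) ≤ 2 * d * (8 * d / P.beta p)⁻¹ := by gcongr
    _ = P.beta p / 4 := by field_simp; norm_num

/-- The union bound over the grid, for the differences of boxes of measure above `η ≥ α_p / 2`. -/
theorem grid_tail_le {η E : ℝ} {m' : ℕ} (hη : P.alpha p / 2 ≤ η)
    (hE : d * (9 * ell P d p + 4 * m') ≤ E) :
    ((⌈8 * d / η⌉₊ + 1 : ℕ) : ℝ) ^ (4 * d) * (2 ^ (2 * d * (2 * m')) * Real.exp (-E)) ≤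
      P.beta p / 4 := by
  obtain ⟨h1, h2, h3, h4, h5, h6⟩ := log_bounds h hp
  have hd := d_pos_real h
  have hα := alpha_pos h p
  have hβ := beta_pos h p
  have hη0 : 0 < η := by linarith
  have hl2 := Real.log_two_gt_d9
  have hl2' := Real.log_two_lt_d9
  have hell := two_le_ell h hp
  have h7 : ((⌈8 * d / η⌉₊ + 1 : ℕ) : ℝ) ≤ Real.exp (2 * ell P d p) := by
    have h8 : (⌈8 * d / η⌉₊ : ℝ) < 8 * d / η + 1 := Nat.ceil_lt_add_one (by positivity)
    have h9 : 8 * d / η ≤ 16 * (d / P.alpha p) := by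
      rw [div_le_iff₀ hη0, mul_div_assoc', div_mul_eq_mul_div, le_div_iff₀ hα]
      nlinarith
    have h10 : 1 ≤ d / P.alpha p := by
      rw [le_div_iff₀ hα]
      linarith [alpha_le h hp]
    have h11 : 32 * (d / P.alpha p) ≤ Real.exp (2 * ell P d p) := by
      rw [← Real.log_le_iff_le_exp (by positivity), Real.log_mul (by norm_num) (by positivity),
        Real.log_div (by positivity) hα.ne', show (32 : ℝ) = 2 ^ 5 by norm_num, Real.log_pow,
        ell_eq h hp]
      push_cast
      linarith
    push_cast
    linarith
  have h8 : (2 : ℝ) ^ (2 * d * (2 * m')) ≤ Real.exp (4 * d * m') := by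
    rw [show (2 : ℝ) ^ (2 * d * (2 * m')) = Real.exp (Real.log 2) ^ (2 * d * (2 * m')) by
      rw [Real.exp_log (by norm_num)], ← Real.exp_nat_mul, Real.exp_le_exp]
    push_cast
    have : (0 : ℝ) ≤ d * m' := by positivity
    nlinarith
  have h9 : Real.exp (-ell P d p) ≤ P.beta p / 4 := by
    rw [← Real.le_log_iff_exp_le (by positivity), Real.log_div hβ.ne' (by norm_num),
      show (4 : ℝ) = 2 ^ 2 by norm_num, Real.log_pow, ell_eq h hp]
    push_cast
    linarith
  calc ((⌈8 * d / η⌉₊ + 1 : ℕ) : ℝ) ^ (4 * d) * (2 ^ (2 * d * (2 * m')) * Real.exp (-E))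
      ≤ Real.exp (2 * ell P d p) ^ (4 * d) * (Real.exp (4 * d * m') * Real.exp (-E)) := by gcongr
    _ = Real.exp (8 * d * ell P d p + 4 * d * m' - E) := by
        rw [← Real.exp_nat_mul, ← Real.exp_add, ← Real.exp_add]
        push_cast
        ring_nf
    _ ≤ Real.exp (-ell P d p) := by
        rw [Real.exp_le_exp]
        nlinarith
    _ ≤ P.beta p / 4 := h9

theorem fresh_exponent_le : d * (9 * ell P d p + 4 * P.m d (p + 1)) ≤
    P.t d p * (P.γ * (P.alpha (p + 1) / 2) / 2) := by
  have h1 := ell_le_m h hp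
  have h2 := m_succ_le h hp
  have h3 := le_t P d p
  have h4 := one_le_m h hp
  have h5 := h.ct_ge
  have hd := d_pos_real h
  have hα := alpha_pos h p
  have hγ := h.γ_pos
  have h6 : P.alpha (p + 1) = P.alpha p / 2 := by
    rw [Params.alpha, Params.alpha, pow_succ, div_div]
  rw [div_le_iff₀ (by positivity)] at h3
  calc d * (9 * ell P d p + 4 * P.m d (p + 1)) ≤ d * (9 * P.m d p + 4 * (64 * P.m d p)) := by gcongr
    _ = 265 * (d * P.m d p) := by ring
    _ ≤ (P.ct / 8) * (d * P.m d p) := by gcongr; linarith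
    _ = P.ct * d * P.m d p / 8 := by ring
    _ ≤ P.t d p * (P.γ * P.alpha p) / 8 := by gcongr
    _ = P.t d p * (P.γ * (P.alpha (p + 1) / 2) / 2) := by rw [h6]; ring

omit hp in
/-- In the first phase, `ell` is bounded in terms of the logarithm in the sample complexity. -/
theorem ell_one_le : ell P d 1 ≤ (2 * Real.log (1 / P.cδ) + 5 * P.aδ + 7) *
    Real.log (2 * d / (P.α * P.β * P.γ * P.ε * P.δstar)) := by
  have hd := d_pos_real h
  have hα := h.α_pos
  have hβ := h.β_pos
  have hγ := h.γ_pos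
  have hε := h.ε_pos
  have hδs := h.δstar_pos
  have hcδ := h.cδ_pos
  have hl2 := Real.log_two_gt_d9
  have hQ0 := deltaMain_pos h 1
  have hQ := deltaMain_le h le_rfl
  have hu := two_le_log_deltaMain h le_rfl
  have h1 := Real.log_nonneg hd
  have h2 := Real.log_nonpos hα.le h.α_lt.le
  have h3 := Real.log_nonpos hβ.le h.β_lt.le
  have h4 := Real.log_nonpos hγ.le h.γ_le
  have h5 := Real.log_nonpos hε.le h.ε_le
  have h6 := Real.log_nonpos hδs.le h.δstar_lt.le
  have h7 : 0 ≤ Real.log (1 / P.cδ) := Real.log_nonneg (by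
    rw [le_div_iff₀ hcδ]; linarith [h.cδ_le])
  have hY : Real.log (2 * d / (P.α * P.β * P.γ * P.ε * P.δstar)) = Real.log 2 + Real.log d -
      Real.log P.α - Real.log P.β - Real.log P.γ - Real.log P.ε - Real.log P.δstar := by
    rw [Real.log_div (by positivity) (by positivity), Real.log_mul (by norm_num) (by positivity),
      Real.log_mul (by positivity) hδs.ne', Real.log_mul (by positivity) hε.ne',
      Real.log_mul (by positivity) hγ.ne', Real.log_mul hα.ne' hβ.ne']
    ring
  set Y := Real.log (2 * d / (P.α * P.β * P.γ * P.ε * P.δstar)) with hYdef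
  have hu' : Real.log (1 / P.deltaMain d 1) = 3 * Real.log 2 + Real.log d - Real.log P.δstar -
      Real.log P.γ - Real.log P.α - 2 * Real.log P.ε - Real.log P.β := by
    rw [Params.deltaMain, one_div, Real.log_inv, Real.log_div (by positivity) (by positivity),
      Real.log_mul (by positivity) hβ.ne', Real.log_mul (by positivity) (by positivity),
      Real.log_mul (by positivity) hα.ne', Real.log_mul hδs.ne' hγ.ne',
      Real.log_mul (by positivity) (by norm_num), Real.log_pow, pow_one,
      show (8 : ℝ) = 2 ^ 3 by norm_num, Real.log_pow]
    push_cast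
    ring
  set u := Real.log (1 / P.deltaMain d 1) with hudef
  have huY : u ≤ 5 * Y := by linarith
  have hlogu : Real.log u ≤ u := Real.log_le_self (by linarith)
  have hδ : Real.log (P.delta d 1) = -Real.log (1 / P.cδ) - u - P.aδ * Real.log u := by
    have h8 : Real.log (P.deltaMain d 1) = -u := by
      rw [hudef, one_div, Real.log_inv, neg_neg]
    rw [Params.delta, ← hudef, Real.log_div (by positivity) (by positivity),
      Real.log_mul hcδ.ne' hQ0.ne', Real.log_pow, h8, one_div, Real.log_inv]
    ring
  have hα1 : Real.log (P.alpha 1) = Real.log P.α - Real.log 2 := by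
    rw [Params.alpha, pow_one, Real.log_div hα.ne' (by norm_num)]
  have hβ1 : Real.log (P.beta 1) = Real.log P.β - Real.log 2 := by
    rw [Params.beta, pow_one, Real.log_div hβ.ne' (by norm_num)]
  have hY2 : Real.log 2 ≤ Y := by linarith
  have h9 : (P.aδ : ℝ) * Real.log u ≤ P.aδ * (5 * Y) := by
    gcongr
    linarith
  have h10 : Real.log (1 / P.cδ) ≤ 2 * Real.log (1 / P.cδ) * Y := by nlinarith
  rw [ell_eq h le_rfl, hα1, hβ1, hδ]
  nlinarith

omit hp in
theorem sample_exponent_le {n : ℕ}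
    (hn : 208 * P.cm * (2 * Real.log (1 / P.cδ) + 5 * P.aδ + 7) ^ 5 * (d / (P.α * P.ε ^ 2)) *
      Real.log (2 * d / (P.α * P.β * P.γ * P.ε * P.δstar)) ^ 5 ≤ n) :
    d * (9 * ell P d 1 + 4 * P.m d 1) ≤ n * (P.alpha 1 / 2 / 2) := by
  have hd := d_pos_real h
  have hα := h.α_pos
  have hε := h.ε_pos
  have hcm := h.one_le_cm
  have h1 := ell_le_m h (le_refl 1)
  have h2 := m_le h (le_refl 1)
  have h3 := ell_one_le h
  have h4 := two_le_ell h (le_refl 1)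
  have h5 := pow_le_pow_left₀ (by linarith) h3 5
  set C := 2 * Real.log (1 / P.cδ) + 5 * P.aδ + 7
  set Y := Real.log (2 * d / (P.α * P.β * P.γ * P.ε * P.δstar))
  have h6 : P.alpha 1 = P.α / 2 := by rw [Params.alpha, pow_one]
  calc d * (9 * ell P d 1 + 4 * P.m d 1) ≤ d * (9 * P.m d 1 + 4 * P.m d 1) := by gcongr
    _ = 13 * d * P.m d 1 := by ring
    _ ≤ 13 * d * (2 * (P.cm / P.ε ^ 2 * (C * Y) ^ 5)) := by
      gcongr
      exact h2.trans (by gcongr)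
    _ = (208 * P.cm * C ^ 5 * (d / (P.α * P.ε ^ 2)) * Y ^ 5) * (P.α / 8) := by
      field_simp
      ring
    _ ≤ n * (P.α / 8) := by gcongr
    _ = n * (P.alpha 1 / 2 / 2) := by rw [h6]; ring

end Estimates

/-- The requirement on `cm` in `Admissible` holds for all large `cm`, as `log ^ 2` grows slower than
linearly. -/
theorem eventually_le_cm {ct : ℝ} (hct : 0 < ct) (cΔ : ℝ) :
    ∀ᶠ cm : ℝ in Filter.atTop, 18 * cΔ ^ 2 * (Real.log (64 * ct * cm) + 7) ^ 2 ≤ cm := by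
  have h1 : Filter.Tendsto (fun cm : ℝ => 64 * ct * cm) Filter.atTop Filter.atTop :=
    Filter.tendsto_id.const_mul_atTop (by positivity)
  have hc : 0 < 1 / (72 * (cΔ ^ 2 + 1) * (64 * ct)) := by positivity
  have h2 := h1.eventually
    ((Real.isLittleO_pow_log_id_atTop (n := 2)).bound hc)
  have h3 := h1.eventually (Real.tendsto_log_atTop.eventually_ge_atTop 7)
  filter_upwards [h2, h3, Filter.eventually_ge_atTop 0] with cm hcm hlog h0
  rw [Real.norm_of_nonneg (by positivity), id, Real.norm_of_nonneg (by positivity)] at hcm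
  set l := Real.log (64 * ct * cm)
  have h4 : (l + 7) ^ 2 ≤ 4 * l ^ 2 := by nlinarith
  calc 18 * cΔ ^ 2 * (l + 7) ^ 2 ≤ 18 * (cΔ ^ 2 + 1) * (4 * l ^ 2) := by
        gcongr
        linarith
    _ ≤ 18 * (cΔ ^ 2 + 1) * (4 * (1 / (72 * (cΔ ^ 2 + 1) * (64 * ct)) * (64 * ct * cm))) := by
        gcongr
    _ = cm := by
        field_simp
        norm_num

/-! ### The game -/

section Game

variable {X : Type} [MeasurableSpace X] (O : PredictionOracle X) {n : ℕ} (F : Adversary X n)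

theorem measurePreserving_sample (μ : Measure X) [IsProbabilityMeasure μ] (γ : ℝ) :
    MeasurePreserving (fun ω : Outcome O F => ω.1) (gameMeasure O F μ γ)
      (Measure.pi fun _ : Fin n => μ) := measurePreserving_fst

theorem measurePreserving_fresh (μ : Measure X) [IsProbabilityMeasure μ] (γ : ℝ) :
    MeasurePreserving (fun ω : Outcome O F => (ω.2.1, ω.2.2.1)) (gameMeasure O F μ γ)
      ((Measure.infinitePi fun _ : ℕ => μ).prod (Measure.infinitePi fun _ : ℕ => coinLaw γ)) :=
  ((MeasurePreserving.id _).prod measurePreserving_fst).comp measurePreserving_snd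

theorem measurePreserving_tape (μ : Measure X) [IsProbabilityMeasure μ] (γ : ℝ) :
    MeasurePreserving (fun ω : Outcome O F => ω.2.2.2.1) (gameMeasure O F μ γ) O.law :=
  measurePreserving_fst.comp
    (measurePreserving_snd.comp (measurePreserving_snd.comp measurePreserving_snd))

variable (c : X → Bool) (ω : Outcome O F)

/-- The query of round `r + 1` of the game. -/
noncomputable def query (r : ℕ) : X :=
  if ω.2.2.1 r then ω.2.1 r
  else F.choose r (ω.2.2.2.2, trainingSet c ω, transcript O F c ω r)

theorem transcript_fst (r : ℕ) (k : Fin r) : (transcript O F c ω r k).1 = query O F c ω k := by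
  induction r with
  | zero => exact k.elim0
  | succ r ih =>
    rw [transcript]
    refine Fin.lastCases ?_ (fun k => ?_) k
    · rw [Fin.snoc_last]
      simp [query]
    · rw [Fin.snoc_castSucc]
      exact ih k


end Game

/-! ### Unfavourable random choices are unlikely -/

section Probability

variable {P : Params} {d : ℕ} (h : Admissible P d)
include h

theorem exp_neg_le_of_log_le {p : ℕ} {v : ℝ}
    (hv : Real.log (16 * d * P.t d (p + 1) / P.beta (p + 1)) ≤ v) :
    ENNReal.ofReal (Real.exp (-v)) ≤
      ENNReal.ofReal (P.beta (p + 1) / (16 * d * P.t d (p + 1))) := by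
  have hd := d_pos_real h
  have ht := one_le_t h (show 1 ≤ p + 1 by omega)
  have hβ := beta_pos h (p + 1)
  refine ENNReal.ofReal_le_ofReal ?_
  rw [← inv_div (16 * d * P.t d (p + 1) : ℝ) (P.beta (p + 1)),
    ← Real.exp_log (show 0 < 16 * d * P.t d (p + 1) / P.beta (p + 1) by positivity), ← Real.exp_neg]
  exact Real.exp_le_exp.2 (by linarith)

theorem measure_not_smallNoise_le (p r : ℕ) :
    tapeLaw P d {tape | ¬ SmallNoise P tape (p + 1) r} ≤
      ENNReal.ofReal (P.beta (p + 1) / (4 * P.t d (p + 1))) := by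
  have hp : 1 ≤ p + 1 := by omega
  have hd := d_pos_real h
  have ht := one_le_t h hp
  have hβ := beta_pos h (p + 1)
  have hscale := stopNoise_pos h hp
  have hbt := btNoise_pos h hp
  have hm := one_le_m h hp
  set e := ENNReal.ofReal (P.beta (p + 1) / (16 * d * P.t d (p + 1))) with he
  have hlap : ∀ v, Real.log (16 * d * P.t d (p + 1) / P.beta (p + 1)) ≤ v →
      stdLaplace {x | v ≤ |x|} ≤ e := by
    intro v hv
    refine (stdLaplace_abs_ge_le ?_).trans (exp_neg_le_of_log_le h hv)
    refine le_trans ?_ hv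
    refine Real.log_nonneg ?_
    rw [le_div_iff₀ hβ]
    have := beta_le h hp
    nlinarith
  have h1 : ∀ q : Idx d, MeasurePreserving (fun tape : Tape d => tape.1 (r, q)) (tapeLaw P d)
      stdLaplace := fun q =>
    (measurePreserving_eval_infinitePi (fun _ : ℕ × Idx d => stdLaplace) (r, q)).comp
      measurePreserving_fst
  have h2 : ∀ q : Idx d, MeasurePreserving (fun tape : Tape d => tape.2.1 (r, q)) (tapeLaw P d)
      stdLaplace := fun q =>
    (measurePreserving_eval_infinitePi (fun _ : ℕ × Idx d => stdLaplace) (r, q)).comp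
      (measurePreserving_fst.comp measurePreserving_snd)
  have hsub : {tape : Tape d | ¬ SmallNoise P tape (p + 1) r} ⊆
      ⋃ q : Idx d, ((fun tape : Tape d => tape.1 (r, q)) ⁻¹'
        {x | P.m d (p + 1) / P.stopNoise d (p + 1) ≤ |x|} ∪
        (fun tape : Tape d => tape.2.1 (r, q)) ⁻¹'
        {x | P.threshold d (p + 1) / P.btNoise d (p + 1) ≤ |x|}) := by
    intro tape ht
    simp only [SmallNoise, Set.mem_ofPred_eq, not_forall] at ht
    obtain ⟨q, hq⟩ := ht
    refine Set.mem_iUnion.2 ⟨q, ?_⟩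
    rw [abs_mul, abs_of_pos hscale, abs_mul, abs_of_pos hbt, not_and_or, not_le, not_lt] at hq
    rcases hq with hq | hq
    · refine Or.inl ?_
      change P.m d (p + 1) / P.stopNoise d (p + 1) ≤ |tape.1 (r, q)|
      rw [div_le_iff₀ hscale, mul_comm]
      exact hq.le
    · refine Or.inr ?_
      change P.threshold d (p + 1) / P.btNoise d (p + 1) ≤ |tape.2.1 (r, q)|
      rw [div_le_iff₀ hbt, mul_comm]
      exact hq
  refine (measure_mono hsub).trans ((measure_iUnion_fintype_le _ _).trans ?_)
  calc ∑ q : Idx d, tapeLaw P d _ ≤ ∑ q : Idx d, (e + e) := by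
        refine Finset.sum_le_sum fun q _ => (measure_union_le _ _).trans (add_le_add ?_ ?_)
        · refine (Measure.le_map_apply (h1 q).aemeasurable _).trans ?_
          rw [(h1 q).map_eq]
          exact hlap _ (log_le_m_div_stopNoise h hp)
        · refine (Measure.le_map_apply (h2 q).aemeasurable _).trans ?_
          rw [(h2 q).map_eq]
          exact hlap _ (log_le_threshold_div_btNoise h hp)
    _ = ENNReal.ofReal (P.beta (p + 1) / (4 * P.t d (p + 1))) := by
        rw [Finset.sum_const, Finset.card_univ, card_idx, he,
          ← ENNReal.ofReal_add (by positivity) (by positivity), ← ENNReal.ofReal_nsmul,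
          nsmul_eq_mul]
        congr 1
        push_cast
        field_simp
        norm_num

theorem measure_noise_le (p : ℕ) :
    tapeLaw P d {tape | ∃ r ∈ Finset.Ico (finish P d p) (finish P d (p + 1)),
      ¬ SmallNoise P tape (p + 1) r} ≤ ENNReal.ofReal (P.beta (p + 1) / 4) := by
  have ht := one_le_t h (show 1 ≤ p + 1 by omega)
  have hβ := beta_pos h (p + 1)
  have hset : {tape : Tape d | ∃ r ∈ Finset.Ico (finish P d p) (finish P d (p + 1)),
      ¬ SmallNoise P tape (p + 1) r} = ⋃ r ∈ Finset.Ico (finish P d p) (finish P d (p + 1)),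
      {tape | ¬ SmallNoise P tape (p + 1) r} := by
    ext; simp
  rw [hset]
  refine (measure_biUnion_finset_le _ _).trans
    ((Finset.sum_le_sum fun r _ => measure_not_smallNoise_le h p r).trans (le_of_eq ?_))
  rw [Finset.sum_const, Nat.card_Ico, finish_succ, Nat.add_sub_cancel_left,
    ← ENNReal.ofReal_nsmul, nsmul_eq_mul]
  congr 1
  field_simp

theorem measure_geom_le (p : ℕ) :
    tapeLaw P d {tape | ∃ q : Idx d, P.m d (p + 1) < tape.2.2 (p + 1, q)} ≤
      ENNReal.ofReal (P.beta (p + 1) / 4) := by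
  have hp : 1 ≤ p + 1 := by omega
  have h1 : ∀ q : Idx d, MeasurePreserving (fun tape : Tape d => tape.2.2 (p + 1, q)) (tapeLaw P d)
      (geometricMeasure
        (Set.projIcc (0 : ℝ) 1 zero_le_one (1 - Real.exp (-P.copyEps d (p + 1))))) :=
    fun q => (measurePreserving_eval_infinitePi (fun q : ℕ × Idx d => geometricMeasure
      (Set.projIcc (0 : ℝ) 1 zero_le_one (1 - Real.exp (-P.copyEps d q.1)))) (p + 1, q)).comp
      (measurePreserving_snd.comp measurePreserving_snd)
  have hset : {tape : Tape d | ∃ q : Idx d, P.m d (p + 1) < tape.2.2 (p + 1, q)} =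
      ⋃ q : Idx d, (fun tape : Tape d => tape.2.2 (p + 1, q)) ⁻¹' {i | P.m d (p + 1) < i} := by
    ext; simp
  rw [hset]
  refine (measure_iUnion_fintype_le _ _).trans ?_
  calc ∑ q : Idx d, tapeLaw P d _
      ≤ ∑ q : Idx d, ENNReal.ofReal (Real.exp (-(P.copyEps d (p + 1) * P.m d (p + 1)))) := by
        refine Finset.sum_le_sum fun q _ => (Measure.le_map_apply (h1 q).aemeasurable _).trans ?_
        rw [(h1 q).map_eq]
        exact geometricMeasure_gt_le (copyEps_pos h hp) _
    _ ≤ ENNReal.ofReal (P.beta (p + 1) / 4) := by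
        rw [Finset.sum_const, Finset.card_univ, card_idx, ← ENNReal.ofReal_nsmul, nsmul_eq_mul]
        refine ENNReal.ofReal_le_ofReal ?_
        have := geom_tail_le h hp
        push_cast
        exact this

theorem ofReal_grid_le {p m' : ℕ} (hp : 1 ≤ p) {η E : ℝ} (hη : P.alpha p / 2 ≤ η)
    (hE : d * (9 * ell P d p + 4 * m') ≤ E) :
    ((⌈8 * d / η⌉₊ + 1 : ℕ) : ENNReal) ^ (4 * d) *
      (2 ^ (2 * d * (2 * m')) * ENNReal.ofReal (Real.exp (-E))) ≤
      ENNReal.ofReal (P.beta p / 4) := by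
  refine le_trans (le_of_eq ?_) (ENNReal.ofReal_le_ofReal (grid_tail_le h hp hη hE))
  rw [ENNReal.ofReal_mul (by positivity), ENNReal.ofReal_mul (by positivity),
    ENNReal.ofReal_pow (by positivity), ENNReal.ofReal_pow (by positivity),
    ENNReal.ofReal_natCast, ENNReal.ofReal_ofNat]

variable (μ : Measure (Point d)) [IsProbabilityMeasure μ]

theorem measure_fresh_le (p : ℕ) :
    ((Measure.infinitePi fun _ : ℕ => μ).prod (Measure.infinitePi fun _ : ℕ => coinLaw P.γ))
      {w | ∃ A' A : Idx d → Set ℝ, (∀ q, IsLowerSet (A' q)) ∧ (∀ q, IsLowerSet (A q)) ∧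
        P.alpha (p + 2) < μ.real (region A' \ region A) ∧
        freshCount P d w.1 w.2 p (finish P d (p + 1)) (region A' \ region A) ≤
          2 * d * (2 * P.m d (p + 2))} ≤
      ENNReal.ofReal (P.beta (p + 1) / 4) := by
  have hp : 1 ≤ p + 1 := by omega
  have hη := alpha_pos h (p + 2)
  have hd := d_pos_real h
  have hγ := h.γ_pos
  have hM : 0 < ⌈8 * d / P.alpha (p + 2)⌉₊ := Nat.ceil_pos.2 (by positivity)
  refine (measure_exists_region_le μ _
    (fun (w : (ℕ → Point d) × (ℕ → Bool)) R => freshCount P d w.1 w.2 p (finish P d (p + 1)) R)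
    (fun w => freshCount_mono _ _ _ _) (2 * d * (2 * P.m d (p + 2))) hM (Nat.le_ceil _) hη _
    ?_).trans
    (ofReal_grid_le h hp (le_of_eq ?_) (fresh_exponent_le h hp))
  · intro R hR hle
    refine (measure_freshCount_le μ hγ.le h.γ_le hR _ p).trans ?_
    gcongr
  · rw [Params.alpha, Params.alpha, pow_succ _ (p + 1), div_div]

theorem measure_sample_le {n : ℕ}
    (hn : 208 * P.cm * (2 * Real.log (1 / P.cδ) + 5 * P.aδ + 7) ^ 5 * (d / (P.α * P.ε ^ 2)) *
      Real.log (2 * d / (P.α * P.β * P.γ * P.ε * P.δstar)) ^ 5 ≤ n) :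
    (Measure.pi fun _ : Fin n => μ)
      {S | ∃ A' A : Idx d → Set ℝ, (∀ q, IsLowerSet (A' q)) ∧ (∀ q, IsLowerSet (A q)) ∧
        P.alpha 1 < μ.real (region A' \ region A) ∧
        sampleCount S (region A' \ region A) ≤ 2 * d * (2 * P.m d 1)} ≤
      ENNReal.ofReal (P.beta 1 / 4) := by
  have hη := alpha_pos h 1
  have hd := d_pos_real h
  have hM : 0 < ⌈8 * d / P.alpha 1⌉₊ := Nat.ceil_pos.2 (by positivity)
  refine (measure_exists_region_le μ _ (fun S R => sampleCount S R)
    sampleCount_mono (2 * d * (2 * P.m d 1)) hM (Nat.le_ceil _) hη _ ?_).trans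
    (ofReal_grid_le h le_rfl (by linarith) (sample_exponent_le h hn))
  · intro R hR hle
    refine (measure_sampleCount_le μ hR _).trans ?_
    gcongr

/-- Against every adversary, the random choices of the game are favourable with probability at least
`1 - β`. -/
theorem measure_not_favourable_le {n : ℕ}
    (hn : 208 * P.cm * (2 * Real.log (1 / P.cδ) + 5 * P.aδ + 7) ^ 5 * (d / (P.α * P.ε ^ 2)) *
      Real.log (2 * d / (P.α * P.β * P.γ * P.ε * P.δstar)) ^ 5 ≤ n)
    (F : Adversary (Point d) n) :
    gameMeasure (RectanglesPERP P d) F μ P.γ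
      {ω | ¬ Favourable P μ ω.2.2.2.1 ω.1 ω.2.1 ω.2.2.1} ≤ ENNReal.ofReal P.β := by
  set G := gameMeasure (RectanglesPERP P d) F μ P.γ with hG
  have hS := measurePreserving_sample (RectanglesPERP P d) F μ P.γ
  have hZ := measurePreserving_fresh (RectanglesPERP P d) F μ P.γ
  have hT : MeasurePreserving (fun ω : Outcome (RectanglesPERP P d) F => ω.2.2.2.1) G
      (tapeLaw P d) := measurePreserving_tape (RectanglesPERP P d) F μ P.γ
  set BS := {S : Fin n → Point d | ∃ A' A : Idx d → Set ℝ, (∀ q, IsLowerSet (A' q)) ∧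
    (∀ q, IsLowerSet (A q)) ∧ P.alpha 1 < μ.real (region A' \ region A) ∧
    sampleCount S (region A' \ region A) ≤ 2 * d * (2 * P.m d 1)} with hBS
  set BZ : ℕ → Set ((ℕ → Point d) × (ℕ → Bool)) := fun p =>
    {w | ∃ A' A : Idx d → Set ℝ, (∀ q, IsLowerSet (A' q)) ∧ (∀ q, IsLowerSet (A q)) ∧
      P.alpha (p + 2) < μ.real (region A' \ region A) ∧
      freshCount P d w.1 w.2 p (finish P d (p + 1)) (region A' \ region A) ≤
        2 * d * (2 * P.m d (p + 2))} with hBZ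
  set BN : ℕ → Set (Tape d) := fun p =>
    {tape | ∃ r ∈ Finset.Ico (finish P d p) (finish P d (p + 1)),
      ¬ SmallNoise P tape (p + 1) r} with hBN
  set BG : ℕ → Set (Tape d) := fun p =>
    {tape | ∃ q : Idx d, P.m d (p + 1) < tape.2.2 (p + 1, q)} with hBG
  have hsub : {ω : Outcome (RectanglesPERP P d) F |
      ¬ Favourable P μ ω.2.2.2.1 ω.1 ω.2.1 ω.2.2.1} ⊆
      (fun ω : Outcome (RectanglesPERP P d) F => ω.1) ⁻¹' BS ∪ ⋃ p : ℕ,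
        ((fun ω : Outcome (RectanglesPERP P d) F => (ω.2.1, ω.2.2.1)) ⁻¹' BZ p ∪
          ((fun ω : Outcome (RectanglesPERP P d) F => ω.2.2.2.1) ⁻¹' BN p ∪
            (fun ω : Outcome (RectanglesPERP P d) F => ω.2.2.2.1) ⁻¹' BG p)) := by
    intro ω hω
    by_contra hnot
    simp only [Set.mem_union, Set.mem_iUnion, not_or, not_exists] at hnot
    obtain ⟨h1, h2⟩ := hnot
    refine hω ⟨fun p r hr => ?_, fun p q => ?_, fun A' A hA' hA hlt => ?_,
      fun p A' A hA' hA hlt => ?_⟩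
    · by_contra hc
      exact (h2 p).2.1 ⟨r, hr, hc⟩
    · by_contra hc
      exact (h2 p).2.2 ⟨q, not_le.1 hc⟩
    · by_contra hc
      exact h1 ⟨A', A, hA', hA, hlt, not_lt.1 hc⟩
    · by_contra hc
      exact (h2 p).1 ⟨A', A, hA', hA, hlt, not_lt.1 hc⟩
  have hβ := h.β_pos
  have hphase : ∀ p : ℕ,
      G ((fun ω : Outcome (RectanglesPERP P d) F => (ω.2.1, ω.2.2.1)) ⁻¹' BZ p ∪
          ((fun ω : Outcome (RectanglesPERP P d) F => ω.2.2.2.1) ⁻¹' BN p ∪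
            (fun ω : Outcome (RectanglesPERP P d) F => ω.2.2.2.1) ⁻¹' BG p)) ≤
      ENNReal.ofReal ((3 / 4 * P.β) / 2 / 2 ^ p) := by
    intro p
    have hβp := beta_pos h (p + 1)
    have e1 := (Measure.le_map_apply hZ.aemeasurable (BZ p)).trans
      (hZ.map_eq ▸ measure_fresh_le h μ p)
    have e2 := (Measure.le_map_apply hT.aemeasurable (BN p)).trans
      (hT.map_eq ▸ measure_noise_le h p)
    have e3 := (Measure.le_map_apply hT.aemeasurable (BG p)).trans
      (hT.map_eq ▸ measure_geom_le h p)
    refine (measure_union_le _ _).trans ((add_le_add e1 ((measure_union_le _ _).trans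
      (add_le_add e2 e3))).trans (le_of_eq ?_))
    rw [← ENNReal.ofReal_add (by positivity) (by positivity),
      ← ENNReal.ofReal_add (by positivity) (by positivity)]
    congr 1
    rw [Params.beta, pow_succ]
    field_simp
    norm_num
  have e0 := (Measure.le_map_apply hS.aemeasurable BS).trans
    (hS.map_eq ▸ measure_sample_le h μ hn)
  refine (measure_mono hsub).trans ((measure_union_le _ _).trans
    ((add_le_add e0 ((measure_iUnion_le _).trans (ENNReal.tsum_le_tsum hphase))).trans ?_))
  rw [← ENNReal.ofReal_tsum_of_nonneg (fun p => by positivity) (summable_geometric_two' _),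
    tsum_geometric_two', ← ENNReal.ofReal_add (by have := beta_pos h 1; positivity) (by positivity)]
  refine ENNReal.ofReal_le_ofReal ?_
  rw [Params.beta]
  linarith

end Probability

end PERP

theorem mainTheorem1 :
    ∃ ct₀ > (0 : ℝ), ∃ cΔ₀ > (0 : ℝ), ∀ ct ≥ ct₀, ∀ cΔ ≥ cΔ₀,
    ∃ cm₀ > (0 : ℝ), ∀ cm ≥ cm₀, ∀ cδ : ℝ, 0 < cδ → cδ ≤ 1 → ∀ aδ : ℕ,
    ∃ C > (0 : ℝ), ∃ K : ℕ,
    ∀ (d : ℕ) (α β γ ε δstar : ℝ), 1 ≤ d →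
      0 < α → α < 1 → 0 < β → β < 1 → 0 < γ → γ ≤ 1 → 0 < ε → ε ≤ 1 → 0 < δstar → δstar < 1 →
    ∀ n : ℕ,
      C * (d / (α * ε ^ 2)) * Real.log (2 * d / (α * β * γ * ε * δstar)) ^ K ≤ n →
    ∀ c ∈ PERP.REC d, ∀ (D : MeasureTheory.Measure (PERP.Point d))
      [MeasureTheory.IsProbabilityMeasure D],
      ENNReal.ofReal α < D {x | c x = true} →
      PERP.IsEverlastingRobustPredictorFor
        (PERP.RectanglesPERP
          { ε := ε, δstar := δstar, α := α, β := β, γ := γ,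
            cδ := cδ, aδ := aδ, cm := cm, ct := ct, cΔ := cΔ } d)
        α β γ n c D := by
  refine ⟨2120, by norm_num, 40, by norm_num, fun ct hct cΔ hcΔ => ?_⟩
  obtain ⟨c₀, hc₀⟩ := Filter.eventually_atTop.1
    (PERP.eventually_le_cm (show 0 < ct by linarith) cΔ)
  refine ⟨max c₀ 1, by positivity, fun cm hcm cδ hcδ hcδ1 aδ => ?_⟩
  have hcm1 : 1 ≤ cm := (le_max_right _ _).trans hcm
  have hlog : 0 ≤ Real.log (1 / cδ) := Real.log_nonneg (by
    rw [le_div_iff₀ hcδ]; linarith)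
  refine ⟨208 * cm * (2 * Real.log (1 / cδ) + 5 * aδ + 7) ^ 5, by positivity, 5, ?_⟩
  intro d α β γ ε δstar hd hα hα1 hβ hβ1 hγ hγ1 hε hε1 hδ hδ1 n hn c hc D _ hD F
  obtain ⟨a, b, rfl⟩ := hc
  set P : PERP.Params :=
    { ε := ε, δstar := δstar, α := α, β := β, γ := γ,
      cδ := cδ, aδ := aδ, cm := cm, ct := ct, cΔ := cΔ } with hP
  have hadm : PERP.Admissible P d := ⟨hd, hα, hα1, hβ, hβ1, hγ, hγ1, hε, hε1, hδ, hδ1, hcδ, hcδ1,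
    hct, hcΔ, hc₀ cm ((le_max_left _ _).trans hcm), hcm1⟩
  have hμ : P.α < D.real (PERP.region fun q => Set.Iic (PERP.faces a b q)) := by
    have hset : {x | PERP.rectangle a b x = true} =
        PERP.region fun q => Set.Iic (PERP.faces a b q) := by
      ext x
      exact PERP.rectangle_eq_true
    rw [hset] at hD
    exact (ENNReal.ofReal_lt_iff_lt_toReal hα.le (MeasureTheory.measure_ne_top _ _)).1 hD
  refine le_trans (MeasureTheory.measure_mono ?_) (PERP.measure_not_favourable_le hadm D hn F)
  rintro ω ⟨r, hr⟩ hfav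
  refine not_le.2 hr ?_
  have key := PERP.measure_error_le hd (PERP.fit hadm) hα hμ hfav (PERP.rectangle a b)
    (fun x => PERP.rectangle_eq_true)
    (PERP.query (PERP.RectanglesPERP P d) F (PERP.rectangle a b) ω)
    (fun r hr => if_pos hr) r
  rw [PERP.hypothesis]
  simp_rw [PERP.transcript_fst]
  exact key
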